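/- Let $d\ge 1$. Let $X$ be a non-negative random field on $\mathbb{R}^d$ with continuous sample paths and law $\mathbb{P}_X$ on $C(\mathbb{R}^d)$ (the storm process), let $\Psi$ be a random field on $\mathbb{R}^d$ with continuous sample paths that is almost surely strictly positive (the intensity process), and let $\mu_Y>0$. Assume that (a) for some constants $C,R>0$, almost surely $X\le C\,\mathbf{1}_{B_R(o)}$, where $B_R(o)$ is the closed ball of radius $R$ centred at the origin $o$; (b) there is $r>0$ such that $\mathbb{P}_X\big(B_r(o)\subset\{s: X(s)>0\}\big)>0$; (c) almost surely $X(s)>0$ for all $s\in\mathbb{R}^d$ with $\|s\|<R$. Let $N=\sum_i\delta_{(s_i,u_i,X_i)}$ be a Cox process that, conditionally on $\Psi=\psi$, is a Poisson process on $\mathbb{R}^d\times(0,\infty)\times C(\mathbb{R}^d)$ with directing measure $\mu_Y^{-1}\psi(s)\,ds\;u^{-2}du\;d\mathbb{P}_X$, and let $Y(t)=\bigvee_i u_iX_i(t-s_i)$. Let $Y^*$ be, conditionally on $\Psi=\psi$, a copy of $Y$ that is independent of $N$. Let $K\subset\mathbb{R}^d$ be compact, put $K_\rho=\{t+v: t\in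 K,\ \|v\|\le\rho\}$ (empty for $\rho<0$), and let $$N_K^{Y^*}=\sum_i\delta_{s_i}\mathbf{1}\Big\{\sup_{t\in K}X_i(t-s_i)/Y^*(t)\ge u_i^{-1}\Big\}.$$ For a realization $\psi$ of $\Psi$ and a realization $y$ of $Y^*$ put $$b_K^y(s)=\mu_Y^{-1}\,\mathbb{E}_X\Big[\sup_{t\in K}\frac{X(t-s)}{y(t)}\Big],\qquad c_K^y=\int_{\mathbb{R}^d} b_K^y(s)\psi(s)\,ds .$$ Given $\Psi=\psi$ and $Y^*=y$, let $\varphi_1,\varphi_2,\dots$ be i.i.d. realizations of the point process $N_K^{Y^*}$ conditioned on $\Psi=\psi$, $Y^*=y$, and let $t_1,\dots,t_{m_n}$ be the points of $\varphi_1+\dots+\varphi_n$. Let $k:\mathbb{R}^d\to\mathbb{R}$ be a measurable kernel with $\int k(s)\,ds=1$ that is continuous almost everywhere and satisfies $|k(s)|\le L(\|s\|)$ for some nonincreasing $L$ on $[0,\infty)$ such that $s\mapsto L(\|s\|)$ is integrable on $\mathbb{R}^d$. Let $h_n>0$ be bandwidths with $h_n\to0$ and $nh_n^d/|\log n|\to\infty$,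 and define $$\widehat\psi_{K,n}(s)=\big[b_K^y(s)\big]^{-1}\,\frac{1}{m_nh_{m_n}^d}\sum_{i=1}^{m_n}k\Big(\frac{s-t_i}{h_{m_n}}\Big).$$ Then, for almost every realization $\psi$ of $\Psi$ and almost every realization $y$ of $Y^*$ given $\Psi=\psi$, almost surely for all $\varepsilon>0$ $$\sup_{s\in K_{R-\varepsilon}}\big|c_K^y\,\widehat\psi_{K,n}(s)-\psi(s)\big|\longrightarrow 0\qquad(n\to\infty).$$ -/

import Mathlib

open MeasureTheory ProbabilityTheory Filter Topology
open scoped ENNReal NNReal Pointwise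

noncomputable section

namespace CoxExtremal

/-- Euclidean space `ℝ^d`. -/
abbrev E (d : ℕ) : Type := EuclideanSpace ℝ (Fin d)

/-- The path space `C(ℝ^d)` carries the topology of locally uniform convergence (Mathlib's
compact-open topology) and its Borel `σ`-algebra. -/
instance pathMeasurableSpace (d : ℕ) : MeasurableSpace C(E d, ℝ) := borel _

instance pathBorelSpace (d : ℕ) : BorelSpace C(E d, ℝ) := ⟨rfl⟩

/-- A storm `(s, u, X)`: centre `s`, severity `u`, shape `X`. (Severities live on `(0, ∞)`: the
directing measure `stormIntensity` gives no mass to other values of `u`.) -/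
abbrev Storm (d : ℕ) : Type := E d × ℝ × C(E d, ℝ)

/-- The counting measure `∑ i, δ_{x i}` of a sequence of points. -/
def pointMeasure {S : Type*} [MeasurableSpace S] (x : ℕ → S) : Measure S :=
  Measure.sum fun i => Measure.dirac (x i)

/-- The point process `∑ i, δ_{x i}` on the probability space `(Ω, P)` is a Poisson process with
directing measure `Λ`: the number of points in a measurable set `B` with `Λ B < ∞` is Poisson
distributed with parameter `Λ B`, and the numbers of points in pairwise disjoint measurable sets
are independent. -/
structure IsPoissonProcess {Ω S : Type*} [MeasurableSpace Ω] [MeasurableSpace S]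
    (P : Measure Ω) (x : ℕ → Ω → S) (Λ : Measure S) : Prop where
  measurable : ∀ i, Measurable (x i)
  count_law : ∀ B : Set S, MeasurableSet B → Λ B < ∞ →
    P.map (fun ω => pointMeasure (fun i => x i ω) B) =
      (poissonMeasure (Λ B).toNNReal).map (fun n : ℕ => (n : ℝ≥0∞))
  count_indep : ∀ (m : ℕ) (B : Fin m → Set S), (∀ l, MeasurableSet (B l)) →
    Pairwise (Function.onFun Disjoint B) →
    iIndepFun (fun l ω => pointMeasure (fun i => x i ω) (B l)) P

/-- The point processes `∑ i, δ_{x j i}`, `j = 0, 1, 2, …`, are independent Poisson processes with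
the same directing measure `Λ`. -/
structure IsIIDPoisson {Ω S : Type*} [MeasurableSpace Ω] [MeasurableSpace S]
    (P : Measure Ω) (x : ℕ → ℕ → Ω → S) (Λ : Measure S) : Prop where
  poisson : ∀ j, IsPoissonProcess P (x j) Λ
  indep : iIndepFun (fun j ω => pointMeasure (fun i => x j i ω)) P

/-- The measure `μ⁻¹ ψ(s) ds × u⁻² du × P_X(dX)` on storms, `u > 0`. -/
def stormIntensity {d : ℕ} (μ : ℝ) (PX : Measure C(E d, ℝ)) (ψ : C(E d, ℝ)) :
    Measure (Storm d) :=
  ENNReal.ofReal μ⁻¹ •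
    ((volume.withDensity fun s : E d => ENNReal.ofReal (ψ s)).prod
      (((volume.restrict (Set.Ioi (0 : ℝ))).withDensity
        fun u => ENNReal.ofReal (u ^ 2)⁻¹).prod PX))

/-- The extremal field `Y(t) = ⋁ i, u_i X_i(t - s_i)` of a sequence of storms. -/
def extremalField {d : ℕ} (x : ℕ → Storm d) (t : E d) : ℝ≥0∞ :=
  ⨆ i, ENNReal.ofReal ((x i).2.1 * (x i).2.2 (t - (x i).1))

/-- `sup_{t ∈ K} X(t - s) / y(t)`. -/
def supRatio {d : ℕ} (K : Set (E d)) (y : E d → ℝ≥0∞) (s : E d) (X : C(E d, ℝ)) : ℝ≥0∞ :=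
  ⨆ t ∈ K, ENNReal.ofReal (X (t - s)) / y t

/-- The storm `p = (s, u, X)` is retained by the threshold `y` on `K`:
`sup_{t ∈ K} X(t - s) / y(t) ≥ u⁻¹`. -/
def Contributes {d : ℕ} (K : Set (E d)) (y : E d → ℝ≥0∞) (p : Storm d) : Prop :=
  (ENNReal.ofReal p.2.1)⁻¹ ≤ supRatio K y p.1 p.2.2

/-- The correcting factor `b_K^y(s) = μ⁻¹ 𝔼_X [sup_{t ∈ K} X(t - s) / y(t)]`. -/
def bFactor {d : ℕ} (μ : ℝ) (PX : Measure C(E d, ℝ)) (K : Set (E d)) (y : E d → ℝ≥0∞)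
    (s : E d) : ℝ≥0∞ :=
  ENNReal.ofReal μ⁻¹ * ∫⁻ X, supRatio K y s X ∂PX

/-- The constant `c_K^y = ∫ b_K^y(s) ψ(s) ds`. -/
def cConst {d : ℕ} (μ : ℝ) (PX : Measure C(E d, ℝ)) (ψ : C(E d, ℝ)) (K : Set (E d))
    (y : E d → ℝ≥0∞) : ℝ :=
  (∫⁻ s, bFactor μ PX K y s * ENNReal.ofReal (ψ s)).toReal

/-- The indices `(j, i)` of the points of `φ_0 + ⋯ + φ_{n-1}`, where `φ_j` consists of the centres
of those storms of the `j`-th storm process that are retained by the threshold `y` on `K`. -/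
def sampleIndex {d : ℕ} (K : Set (E d)) (y : E d → ℝ≥0∞) (x : ℕ → ℕ → Storm d) (n : ℕ) :
    Set (ℕ × ℕ) :=
  {q | q.1 < n ∧ Contributes K y (x q.1 q.2)}

/-- The number `m_n` of points of `φ_0 + ⋯ + φ_{n-1}`. -/
def sampleCount {d : ℕ} (K : Set (E d)) (y : E d → ℝ≥0∞) (x : ℕ → ℕ → Storm d) (n : ℕ) : ℕ :=
  (sampleIndex K y x n).ncard

/-- The kernel estimator `(m_n h_{m_n}^d)⁻¹ ∑_t k((s - t) / h_{m_n})`, the sum being over the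
points `t` of `φ_0 + ⋯ + φ_{n-1}`. -/
def kernelEstimator {d : ℕ} (k : E d → ℝ) (h : ℕ → ℝ) (K : Set (E d)) (y : E d → ℝ≥0∞)
    (x : ℕ → ℕ → Storm d) (n : ℕ) (s : E d) : ℝ :=
  1 / ((sampleCount K y x n : ℝ) * h (sampleCount K y x n) ^ d) *
    ∑ᶠ q ∈ sampleIndex K y x n, k ((h (sampleCount K y x n))⁻¹ • (s - (x q.1 q.2).1))

/-- The corrected estimator: the kernel estimator divided by `b_K^y`. -/
def correctedEstimator {d : ℕ} (μ : ℝ) (PX : Measure C(E d, ℝ)) (k : E d → ℝ) (h : ℕ → ℝ)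
    (K : Set (E d)) (y : E d → ℝ≥0∞) (x : ℕ → ℕ → Storm d) (n : ℕ) (s : E d) : ℝ :=
  (bFactor μ PX K y s).toReal⁻¹ * kernelEstimator k h K y x n s

/-- A smoothing kernel on `ℝ^d`: it has integral one, is continuous almost everywhere, and is
dominated by an integrable radially nonincreasing function. -/
structure IsSmoothingKernel {d : ℕ} (k : E d → ℝ) : Prop where
  measurable : Measurable k
  integral_eq_one : ∫ s, k s = 1
  ae_continuousAt : ∀ᵐ s : E d, ContinuousAt k s
  dominated : ∃ L : ℝ → ℝ, AntitoneOn L (Set.Ici 0) ∧ (∀ s, |k s| ≤ L ‖s‖) ∧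
    Integrable (fun s : E d => L ‖s‖)

end CoxExtremal

end

open MeasureTheory ProbabilityTheory Filter Topology
open scoped ENNReal NNReal Pointwise

noncomputable section

namespace CoxExtremal

/-! ### Poisson counts: void probabilities, exponential moments, Chernoff bounds. -/

section Poisson

variable {Ω S : Type*} [MeasurableSpace Ω] [MeasurableSpace S] {P : Measure Ω} {Λ : Measure S}

/-! Fix `ψ` and the threshold `y`. As `u⁻² du` gives mass `r` to `{u ≥ 1/r}`, integrating out
severity and shape shows that the retained centres have intensity `f = b ψ`, of total mass `c`
(`stormIntensity_retained`). On `K` the field `Y*` is almost surely bounded above and away from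
zero, and the shapes are bounded with support in a fixed ball, so `f` is continuous with compact
support. It remains to estimate `f` uniformly by kernel smoothing and to divide by `b`, which is
continuous and positive on the compact set `K_{R-ε}`, hence bounded below there.

Uniformity in `s` comes from a grid of mesh `δ h`. The deterministic half is
`IsSmoothingKernel.eventually_abs_sub_le`: if each cell contains its expected number of points up to
`η n h^d`, the kernel may be replaced by its values at lattice points. The cost is governed by `δ^d`
times the sum of the oscillations of `k` over the lattice, which vanishes as `δ → 0` because `k` is
almost everywhere continuous with an integrable radial majorant. What is left is an approximation of
the identity.

The probabilistic half is `IsIIDPoisson.ae_eventually_cell`: a Chernoff bound makes a bad cell as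
unlikely as `exp(-κ n h^d)`, only `O(h^{-d})` cells matter, and `n h^d / |log n| → ∞` beats that
number. The bandwidth `h_{m_n}` is random, so the union bound also runs over all indices in `[cn/2,
2cn]`, where `m_n` eventually lies by the law of large numbers. Borel–Cantelli concludes. -/

lemma pointMeasure_apply {x : ℕ → S} {B : Set S} (hB : MeasurableSet B) :
    pointMeasure x B = ({i | x i ∈ B}.encard : ℝ≥0∞) := by
  classical
  rw [pointMeasure, Measure.sum_apply _ hB, ← ENNReal.tsum_set_one,
    tsum_subtype {i | x i ∈ B} fun _ => (1 : ℝ≥0∞)]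
  refine tsum_congr fun i => ?_
  rw [Measure.dirac_apply' _ hB]
  simp [Set.indicator_apply]

lemma measurable_pointMeasure {x : ℕ → Ω → S} (hx : ∀ i, Measurable (x i)) {B : Set S}
    (hB : MeasurableSet B) : Measurable fun ω => pointMeasure (fun i => x i ω) B := by
  simp only [pointMeasure, Measure.sum_apply _ hB, Measure.dirac_apply' _ hB]
  exact Measurable.tsum fun i =>
    (measurable_const.indicator hB).comp (hx i)

lemma IsPoissonProcess.ae_lt_top {x : ℕ → Ω → S} (hx : IsPoissonProcess P x Λ) {B : Set S}
    (hB : MeasurableSet B) (hΛ : Λ B < ∞) :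
    ∀ᵐ ω ∂P, pointMeasure (fun i => x i ω) B < ∞ := by
  have hm := measurable_pointMeasure hx.measurable hB
  refine ae_of_ae_map hm.aemeasurable (p := fun z => z < ∞) ?_
  rw [hx.count_law B hB hΛ, ae_map_iff (by fun_prop) measurableSet_Iio]
  exact ae_of_all _ fun n => ENNReal.natCast_lt_top n

lemma IsPoissonProcess.ae_finite {x : ℕ → Ω → S} (hx : IsPoissonProcess P x Λ) {B : Set S}
    (hB : MeasurableSet B) (hΛ : Λ B < ∞) : ∀ᵐ ω ∂P, {i | x i ω ∈ B}.Finite := by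
  filter_upwards [hx.ae_lt_top hB hΛ] with ω hω
  rw [pointMeasure_apply hB] at hω
  rw [← Set.encard_lt_top_iff]
  exact_mod_cast hω

lemma IsPoissonProcess.measure_count_eq_zero {x : ℕ → Ω → S} (hx : IsPoissonProcess P x Λ)
    {B : Set S} (hB : MeasurableSet B) (hΛ : Λ B < ∞) :
    P {ω | ∀ i, x i ω ∉ B} = ENNReal.ofReal (Real.exp (-(Λ B).toReal)) := by
  have hm := measurable_pointMeasure hx.measurable hB
  have h1 : {ω | ∀ i, x i ω ∉ B} = (fun ω => pointMeasure (fun i => x i ω) B) ⁻¹' {0} := by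
    ext ω
    simp [pointMeasure_apply hB, Set.eq_empty_iff_forall_notMem]
  have h2 : ((fun n : ℕ => (n : ℝ≥0∞)) ⁻¹' {0}) = {0} := by
    ext n; simp
  rw [h1, ← Measure.map_apply hm (measurableSet_singleton _), hx.count_law B hB hΛ,
    Measure.map_apply (by fun_prop) (measurableSet_singleton _), h2, poissonMeasure_singleton]
  simp [ENNReal.coe_toNNReal_eq_toReal]

lemma IsPoissonProcess.ae_forall_notMem [IsProbabilityMeasure P] {x : ℕ → Ω → S}
    (hx : IsPoissonProcess P x Λ) {B : Set S} (hΛ : Λ B = 0) :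
    ∀ᵐ ω ∂P, ∀ i, x i ω ∉ B := by
  obtain ⟨B', hBB', hB', h0⟩ := exists_measurable_superset_of_null hΛ
  have hm : MeasurableSet {ω | ∀ i, x i ω ∉ B'} := by
    simp only [Set.ofPred_forall]
    exact MeasurableSet.iInter fun i => (hx.measurable i hB'.compl)
  have h := hx.measure_count_eq_zero hB' (by simp [h0])
  rw [h0] at h
  simp only [ENNReal.toReal_zero, neg_zero, Real.exp_zero, ENNReal.ofReal_one] at h
  have := (prob_compl_eq_zero_iff hm).2 h
  have h3 : ∀ᵐ ω ∂P, ω ∈ {ω | ∀ i, x i ω ∉ B'} := this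
  filter_upwards [h3] with ω hω i hi using hω i (hBB' hi)

lemma IsPoissonProcess.ae_of_ae [IsProbabilityMeasure P] {x : ℕ → Ω → S}
    (hx : IsPoissonProcess P x Λ) {p : S → Prop} (hp : ∀ᵐ z ∂Λ, p z) :
    ∀ᵐ ω ∂P, ∀ i, p (x i ω) := by
  filter_upwards [hx.ae_forall_notMem (B := {z | ¬ p z}) hp] with ω hω i
  simpa using hω i

/-- The probability that every `B k` is empty is at most the void probability `exp(-Λ (B k))` of
each one, which tends to zero. Monotonicity of `B` plays no role. -/
lemma IsPoissonProcess.ae_exists_mem [IsProbabilityMeasure P] {x : ℕ → Ω → S}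
    (hx : IsPoissonProcess P x Λ) {B : ℕ → Set S} (hB : ∀ k, MeasurableSet (B k))
    (hΛ : ∀ k, Λ (B k) < ∞) (hlim : Tendsto (fun k => (Λ (B k)).toReal) atTop atTop) :
    ∀ᵐ ω ∂P, ∃ k i, x i ω ∈ B k := by
  have h1 : Tendsto (fun k => ENNReal.ofReal (Real.exp (-(Λ (B k)).toReal))) atTop (𝓝 0) := by
    rw [← ENNReal.ofReal_zero]
    exact ENNReal.tendsto_ofReal (Real.tendsto_exp_neg_atTop_nhds_zero.comp hlim)
  have h2 : P {ω | ¬ ∃ k i, x i ω ∈ B k} ≤ 0 := by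
    refine ge_of_tendsto' h1 fun k => ?_
    rw [← hx.measure_count_eq_zero (hB k) (hΛ k)]
    refine measure_mono fun ω hω i hi => hω ⟨k, i, hi⟩
  exact le_antisymm h2 zero_le

/-- The number of points in `B` of the superposition of the first `n` point processes. -/
def totalCount (x : ℕ → ℕ → S) (n : ℕ) (B : Set S) : ℝ :=
  ∑ j ∈ Finset.range n, (pointMeasure (x j) B).toReal

lemma integrable_exp_mul_natCast_poisson (r : ℝ≥0) (t : ℝ) :
    Integrable (fun n : ℕ => Real.exp (t * n)) (poissonMeasure r) := by
  rw [integrable_poissonMeasure_iff]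
  have h := (Real.summable_pow_div_factorial (r * Real.exp t)).mul_left (Real.exp (-r))
  refine h.congr fun n => ?_
  rw [Real.norm_of_nonneg (Real.exp_pos _).le, mul_pow, ← Real.exp_nat_mul, mul_comm (n : ℝ) t]
  ring

lemma integral_exp_mul_natCast_poisson (r : ℝ≥0) (t : ℝ) :
    ∫ n : ℕ, Real.exp (t * n) ∂(poissonMeasure r) = Real.exp (r * (Real.exp t - 1)) := by
  rw [integral_poissonMeasure]
  have h : ∀ n : ℕ, (Real.exp (-r) * r ^ n / (n.factorial : ℝ)) • Real.exp (t * n) =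
      Real.exp (-r) * ((r * Real.exp t) ^ n / n.factorial) := by
    intro n
    rw [smul_eq_mul, mul_pow, ← Real.exp_nat_mul, mul_comm (n : ℝ) t]
    ring
  simp_rw [h]
  rw [tsum_mul_left, ← congrFun (NormedSpace.exp_eq_tsum_div (𝔸 := ℝ)) _, ← Real.exp_eq_exp_ℝ,
    ← Real.exp_add]
  congr 1; ring

lemma IsPoissonProcess.map_toReal {x : ℕ → Ω → S} (hx : IsPoissonProcess P x Λ) {B : Set S}
    (hB : MeasurableSet B) (hΛ : Λ B < ∞) :
    P.map (fun ω => (pointMeasure (fun i => x i ω) B).toReal) =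
      (poissonMeasure (Λ B).toNNReal).map (fun n : ℕ => (n : ℝ)) := by
  have hm := measurable_pointMeasure hx.measurable hB
  have h := congrArg (Measure.map ENNReal.toReal) (hx.count_law B hB hΛ)
  rw [Measure.map_map (by fun_prop) hm, Measure.map_map (by fun_prop) (by fun_prop)] at h
  simpa [Function.comp_def] using h

lemma IsPoissonProcess.integrable_exp_mul {x : ℕ → Ω → S} (hx : IsPoissonProcess P x Λ)
    {B : Set S} (hB : MeasurableSet B) (hΛ : Λ B < ∞) (t : ℝ) :
    Integrable (fun ω => Real.exp (t * (pointMeasure (fun i => x i ω) B).toReal)) P := by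
  have hm := (measurable_pointMeasure hx.measurable hB).ennreal_toReal
  have h2 : Integrable (fun z : ℝ => Real.exp (t * z))
      (P.map (fun ω => (pointMeasure (fun i => x i ω) B).toReal)) := by
    rw [hx.map_toReal hB hΛ, integrable_map_measure (by fun_prop) (by fun_prop)]
    exact integrable_exp_mul_natCast_poisson _ _
  exact (integrable_map_measure (by fun_prop) hm.aemeasurable).1 h2

lemma IsPoissonProcess.mgf_count {x : ℕ → Ω → S} (hx : IsPoissonProcess P x Λ)
    {B : Set S} (hB : MeasurableSet B) (hΛ : Λ B < ∞) (t : ℝ) :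
    mgf (fun ω => (pointMeasure (fun i => x i ω) B).toReal) P t =
      Real.exp ((Λ B).toReal * (Real.exp t - 1)) := by
  have hm := (measurable_pointMeasure hx.measurable hB).ennreal_toReal
  have h := integral_map hm.aemeasurable (f := fun z : ℝ => Real.exp (t * z)) (μ := P)
    (by fun_prop)
  rw [mgf, ← h, hx.map_toReal hB hΛ, integral_map (by fun_prop) (by fun_prop),
    integral_exp_mul_natCast_poisson]
  rfl

lemma IsIIDPoisson.iIndepFun_count {x : ℕ → ℕ → Ω → S} (hx : IsIIDPoisson P x Λ) {B : Set S}
    (hB : MeasurableSet B) :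
    iIndepFun (fun j ω => (pointMeasure (fun i => x j i ω) B).toReal) P :=
  hx.indep.comp (fun _ (ν : Measure S) => (ν B).toReal)
    fun _ => (Measure.measurable_coe hB).ennreal_toReal

/-- Chernoff bound for the number of points of a superposition of Poisson processes. -/
lemma IsIIDPoisson.measure_abs_ge_le [IsProbabilityMeasure P] {x : ℕ → ℕ → Ω → S} (hx : IsIIDPoisson P x Λ) {B : Set S}
    (hB : MeasurableSet B) (hΛ : Λ B < ∞) (n : ℕ) {θ : ℝ} (h0 : 0 ≤ θ) (h1 : θ ≤ 1) (a : ℝ) :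
    P.real {ω | a ≤ |totalCount (fun j i => x j i ω) n B - n * (Λ B).toReal|} ≤
      2 * Real.exp (n * (Λ B).toReal * θ ^ 2 - θ * a) := by
  set l := (Λ B).toReal with hl
  have hl0 : 0 ≤ l := ENNReal.toReal_nonneg
  set X : ℕ → Ω → ℝ := fun j ω => (pointMeasure (fun i => x j i ω) B).toReal with hX
  have hXm : ∀ j, Measurable (X j) := fun j =>
    (measurable_pointMeasure (hx.poisson j).measurable hB).ennreal_toReal
  set Z : Ω → ℝ := ∑ j ∈ Finset.range n, X j with hZ
  have hZe : ∀ ω, totalCount (fun j i => x j i ω) n B = Z ω := by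
    intro ω; simp [totalCount, hZ, hX]
  have hint : ∀ t, Integrable (fun ω => Real.exp (t * Z ω)) P := fun t =>
    (hx.iIndepFun_count hB).integrable_exp_mul_sum hXm fun j _ =>
      (hx.poisson j).integrable_exp_mul hB hΛ t
  have hmgf : ∀ t, mgf Z P t = Real.exp (n * l * (Real.exp t - 1)) := by
    intro t
    rw [hZ, (hx.iIndepFun_count hB).mgf_sum hXm]
    rw [Finset.prod_congr rfl fun j _ => (hx.poisson j).mgf_count hB hΛ t]
    rw [Finset.prod_const, Finset.card_range, ← Real.exp_nat_mul]
    congr 1; ring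
  -- This turns the Poisson exponent `n l (e^t - 1)` into `n l (t + t²)`; with `t = ±θ` the linear
  -- term cancels the centring in either tail.
  have hexp : ∀ t : ℝ, |t| ≤ 1 → Real.exp t - 1 ≤ t + t ^ 2 := fun t ht => by
    have := (abs_le.1 (Real.abs_exp_sub_one_sub_id_le ht)).2
    linarith
  have hup : P.real {ω | n * l + a ≤ Z ω} ≤ Real.exp (n * l * θ ^ 2 - θ * a) := by
    refine (measure_ge_le_exp_mul_mgf _ h0 (hint θ)).trans ?_
    rw [hmgf, ← Real.exp_add]
    refine Real.exp_le_exp.2 ?_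
    have := mul_le_mul_of_nonneg_left (hexp θ (by rwa [abs_of_nonneg h0]))
      (by positivity : (0:ℝ) ≤ n * l)
    linarith
  have hlo : P.real {ω | Z ω ≤ n * l - a} ≤ Real.exp (n * l * θ ^ 2 - θ * a) := by
    refine (measure_le_le_exp_mul_mgf _ (neg_nonpos.2 h0) (hint (-θ))).trans ?_
    rw [hmgf, ← Real.exp_add]
    refine Real.exp_le_exp.2 ?_
    have := mul_le_mul_of_nonneg_left (hexp (-θ) (by rwa [abs_neg, abs_of_nonneg h0]))
      (by positivity : (0:ℝ) ≤ n * l)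
    linarith
  have hsub : {ω | a ≤ |totalCount (fun j i => x j i ω) n B - n * l|} ⊆
      {ω | n * l + a ≤ Z ω} ∪ {ω | Z ω ≤ n * l - a} := by
    intro ω hω
    simp only [Set.mem_ofPred_eq, hZe, le_abs] at hω
    rcases hω with h | h
    · left; simp only [Set.mem_ofPred_eq]; linarith
    · right; simp only [Set.mem_ofPred_eq]; linarith
  calc _ ≤ P.real ({ω | n * l + a ≤ Z ω} ∪ {ω | Z ω ≤ n * l - a}) :=
        measureReal_mono hsub
    _ ≤ _ := measureReal_union_le _ _
    _ ≤ _ := by linarith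

end Poisson

/-! ### Discretization of smoothings on a grid. -/

section Cells

variable {d : ℕ}

/-- The index `(⌊t₁/ρ⌋, …, ⌊t_d/ρ⌋)` of the cell of the grid of mesh `ρ` that contains `t`. -/
def cellIndex (ρ : ℝ) (t : E d) : Fin d → ℤ := fun i => ⌊t i / ρ⌋

/-- The cell with index `z` of the grid of mesh `ρ`. -/
def cell (ρ : ℝ) (z : Fin d → ℤ) : Set (E d) := cellIndex ρ ⁻¹' {z}

/-- The corner of the cell with index `z` of the grid of mesh `δ`. -/
def latticePoint (δ : ℝ) (z : Fin d → ℤ) : E d := WithLp.toLp 2 fun i => δ * z i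

lemma measurable_cellIndex (ρ : ℝ) : Measurable (cellIndex (d := d) ρ) := by
  unfold cellIndex
  refine measurable_pi_lambda _ fun i => Int.measurable_floor.comp ?_
  fun_prop

lemma measurableSet_cell (ρ : ℝ) (z : Fin d → ℤ) : MeasurableSet (cell ρ z) :=
  measurable_cellIndex ρ (measurableSet_singleton z)

lemma norm_le_of_abs_le {v : E d} {r : ℝ} (hr : 0 ≤ r) (hv : ∀ i, |v i| ≤ r) :
    ‖v‖ ≤ d * r := by
  rw [EuclideanSpace.norm_eq]
  refine Real.sqrt_le_iff.2 ⟨by positivity, ?_⟩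
  have h1 : ∑ i, ‖v i‖ ^ 2 ≤ ∑ _i : Fin d, r ^ 2 := Finset.sum_le_sum fun i _ => by
    rw [Real.norm_eq_abs]
    exact pow_le_pow_left₀ (abs_nonneg _) (hv i) 2
  refine h1.trans ?_
  rw [Finset.sum_const, Finset.card_univ, Fintype.card_fin, nsmul_eq_mul, mul_pow]
  refine mul_le_mul_of_nonneg_right ?_ (sq_nonneg r)
  have : d ≤ d ^ 2 := Nat.le_self_pow two_ne_zero d
  exact_mod_cast this

/-- Rounding `s` and `t` to the grid of mesh `δ h` changes each coordinate of `(s - t) / h` by `δ`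
times a difference of fractional parts. -/
lemma norm_smul_sub_latticePoint_le {δ h : ℝ} (hδ : 0 < δ) (hh : 0 < h) (s t : E d) :
    ‖h⁻¹ • (s - t) - latticePoint δ (cellIndex (δ * h) s - cellIndex (δ * h) t)‖ ≤ d * δ := by
  refine norm_le_of_abs_le hδ.le fun i => ?_
  have e : (h⁻¹ • (s - t) - latticePoint δ (cellIndex (δ * h) s - cellIndex (δ * h) t)) i =
      δ * (Int.fract (s i / (δ * h)) - Int.fract (t i / (δ * h))) := by
    simp only [latticePoint, cellIndex, PiLp.sub_apply, PiLp.smul_apply, smul_eq_mul,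
      Pi.sub_apply, Int.cast_sub, Int.fract]
    field_simp
    ring
  rw [e, abs_mul, abs_of_pos hδ]
  have h1 := Int.fract_nonneg (s i / (δ * h))
  have h2 := Int.fract_lt_one (s i / (δ * h))
  have h3 := Int.fract_nonneg (t i / (δ * h))
  have h4 := Int.fract_lt_one (t i / (δ * h))
  have : |Int.fract (s i / (δ * h)) - Int.fract (t i / (δ * h))| ≤ 1 := by
    rw [abs_le]; constructor <;> linarith
  nlinarith

lemma norm_sub_latticePoint_le {δ : ℝ} (hδ : 0 < δ) (v : E d) :
    ‖v - latticePoint δ (cellIndex δ v)‖ ≤ d * δ := by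
  have h := norm_smul_sub_latticePoint_le hδ one_pos v 0
  have h0 : cellIndex δ (0 : E d) = 0 := by ext i; simp [cellIndex]
  simpa [h0] using h

lemma lintegral_comp_cellIndex (ν : Measure (E d)) (ρ : ℝ) (g : (Fin d → ℤ) → ℝ≥0∞) :
    ∫⁻ t, g (cellIndex ρ t) ∂ν = ∑' z, g z * ν (cell ρ z) := by
  rw [← lintegral_map (f := g) Measurable.of_discrete (measurable_cellIndex ρ), lintegral_countable']
  refine tsum_congr fun z => ?_
  rw [Measure.map_apply (measurable_cellIndex ρ) (measurableSet_singleton z), cell]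

lemma volume_cell {ρ : ℝ} (hρ : 0 < ρ) (z : Fin d → ℤ) :
    volume (cell (d := d) ρ z) = ENNReal.ofReal (ρ ^ d) := by
  have h : cell ρ z = (WithLp.ofLp : E d → Fin d → ℝ) ⁻¹'
      (Set.univ.pi fun i => Set.Ico (ρ * z i) (ρ * z i + ρ)) := by
    ext t
    simp only [cell, cellIndex, Set.mem_preimage, Set.mem_singleton_iff, funext_iff, Set.mem_pi,
      Set.mem_univ, true_implies, Set.mem_Ico, Int.floor_eq_iff]
    refine forall_congr' fun i => ?_
    rw [le_div_iff₀ hρ, div_lt_iff₀ hρ]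
    constructor <;> rintro ⟨h1, h2⟩ <;> constructor <;> nlinarith
  rw [h, (PiLp.volume_preserving_ofLp (Fin d)).measure_preimage
    (MeasurableSet.univ_pi fun i => measurableSet_Ico).nullMeasurableSet, Real.volume_pi_Ico]
  simp [ENNReal.ofReal_pow hρ.le]

/-- Reads a lattice sum scaled by `ρ^d` as the integral of a step function, so that integrable
envelopes and dominated convergence apply to it. -/
lemma lintegral_comp_cellIndex_volume {ρ : ℝ} (hρ : 0 < ρ) (g : (Fin d → ℤ) → ℝ≥0∞) :
    ∫⁻ t : E d, g (cellIndex ρ t) = (∑' z, g z) * ENNReal.ofReal (ρ ^ d) := by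
  rw [lintegral_comp_cellIndex, ← ENNReal.tsum_mul_right]
  simp_rw [volume_cell hρ]

/-- The oscillation of `k` near the lattice point with index `w`. -/
def cellOsc (k : E d → ℝ) (δ : ℝ) (w : Fin d → ℤ) : ℝ≥0∞ :=
  ⨆ u ∈ Metric.closedBall (latticePoint δ w) (d * δ), ‖k u - k (latticePoint δ w)‖ₑ

/-- On each cell the error of rounding the argument of `k` is at most an oscillation of `k` times
the mass of the cell, itself at most `β`. -/
lemma abs_integral_sub_integral_comp_cellIndex_le {k : E d → ℝ} (hkm : Measurable k) {M : ℝ}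
    (hkb : ∀ v, |k v| ≤ M) {δ h : ℝ} (hδ : 0 < δ) (hh : 0 < h) (ν : Measure (E d))
    [IsFiniteMeasure ν] {A β : ℝ} (hA : ∑' w, cellOsc k δ w ≤ ENNReal.ofReal A) (hA0 : 0 ≤ A)
    (hβ0 : 0 ≤ β) (hβ : ∀ z, ν.real (cell (δ * h) z) ≤ β) (s : E d) :
    |∫ t, k (h⁻¹ • (s - t)) ∂ν -
        ∫ t, k (latticePoint δ (cellIndex (δ * h) s - cellIndex (δ * h) t)) ∂ν| ≤ β * A := by
  have i1 : Integrable (fun t => k (h⁻¹ • (s - t))) ν := by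
    refine Integrable.of_bound (hkm.comp (by fun_prop)).aestronglyMeasurable M
      (ae_of_all _ fun t => hkb _)
  have hm2 : Measurable fun t =>
      k (latticePoint δ (cellIndex (δ * h) s - cellIndex (δ * h) t)) :=
    (Measurable.of_discrete (f := fun z => k (latticePoint δ (cellIndex (δ * h) s - z)))).comp
      (measurable_cellIndex _)
  have i2 := Integrable.of_bound hm2.aestronglyMeasurable (μ := ν) M (ae_of_all _ fun t => hkb _)
  rw [← integral_sub i1 i2, ← Real.norm_eq_abs]
  have hb : ∫⁻ t, ‖k (h⁻¹ • (s - t)) -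
      k (latticePoint δ (cellIndex (δ * h) s - cellIndex (δ * h) t))‖ₑ ∂ν ≤
      ENNReal.ofReal (β * A) := by
    calc _ ≤ ∫⁻ t, cellOsc k δ (cellIndex (δ * h) s - cellIndex (δ * h) t) ∂ν := by
          refine lintegral_mono fun t => ?_
          refine le_iSup₂_of_le (h⁻¹ • (s - t)) ?_ le_rfl
          rw [mem_closedBall_iff_norm]
          exact norm_smul_sub_latticePoint_le hδ hh s t
      _ = ∑' z, cellOsc k δ (cellIndex (δ * h) s - z) * ν (cell (δ * h) z) :=
          lintegral_comp_cellIndex ν _ fun z => cellOsc k δ (cellIndex (δ * h) s - z)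
      _ ≤ ∑' z, cellOsc k δ (cellIndex (δ * h) s - z) * ENNReal.ofReal β := by
          refine ENNReal.tsum_le_tsum fun z => mul_le_mul_right ?_ _
          rw [← ENNReal.ofReal_toReal (measure_ne_top ν (cell (δ * h) z))]
          exact ENNReal.ofReal_le_ofReal (hβ z)
      _ = (∑' z, cellOsc k δ z) * ENNReal.ofReal β := by
          rw [ENNReal.tsum_mul_right]
          congr 1
          -- Reflection and translation permute the lattice; this makes the bound independent of
          -- `s`.
          exact (Equiv.subLeft (cellIndex (δ * h) s)).tsum_eq (cellOsc k δ)
      _ ≤ ENNReal.ofReal A * ENNReal.ofReal β := by gcongr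
      _ = ENNReal.ofReal (β * A) := by rw [mul_comm, ENNReal.ofReal_mul hβ0]
  have h1 := enorm_integral_le_lintegral_enorm (μ := ν) (fun t => k (h⁻¹ • (s - t)) -
      k (latticePoint δ (cellIndex (δ * h) s - cellIndex (δ * h) t)))
  have h2 := h1.trans hb
  rw [← ofReal_norm] at h2
  exact (ENNReal.ofReal_le_ofReal_iff (by positivity)).1 h2

/-- Once discretized, both integrals are lattice sums weighted by cell masses and can be compared
term by term. -/
lemma abs_integral_comp_cellIndex_sub_le {k : E d → ℝ} {M : ℝ}
    (hkb : ∀ v, |k v| ≤ M) {δ ρ : ℝ} {ν₁ ν₂ : Measure (E d)}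
    [IsFiniteMeasure ν₁] [IsFiniteMeasure ν₂]
    (hs : Summable fun w => |k (latticePoint δ w)|) {a : ℝ}
    (ha : ∀ z, |ν₁.real (cell ρ z) - ν₂.real (cell ρ z)| ≤ a) (s : E d) :
    |∫ t, k (latticePoint δ (cellIndex ρ s - cellIndex ρ t)) ∂ν₁ -
        ∫ t, k (latticePoint δ (cellIndex ρ s - cellIndex ρ t)) ∂ν₂| ≤
      a * ∑' w, |k (latticePoint δ w)| := by
  set g : (Fin d → ℤ) → ℝ := fun z => k (latticePoint δ (cellIndex ρ s - z)) with hg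
  have key : ∀ ν : Measure (E d), [IsFiniteMeasure ν] →
      (Summable fun z => ν.real (cell ρ z) * g z) ∧
      ∫ t, k (latticePoint δ (cellIndex ρ s - cellIndex ρ t)) ∂ν =
        ∑' z, ν.real (cell ρ z) * g z := by
    intro ν _
    have hgm : Measurable g := Measurable.of_discrete
    have hi : Integrable g (ν.map (cellIndex ρ)) :=
      Integrable.of_bound hgm.aestronglyMeasurable M (ae_of_all _ fun z => hkb _)
    have e1 : ∀ z, (ν.map (cellIndex ρ)).real {z} = ν.real (cell ρ z) := fun z => by
      rw [map_measureReal_apply (measurable_cellIndex ρ) (measurableSet_singleton z), cell]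
    constructor
    · have hsum : Summable fun z => ν.real (cell ρ z) * M := by
        refine Summable.mul_right _ ?_
        have hfin : ∑' z, ν (cell ρ z) ≠ ∞ := by
          have h1 := lintegral_comp_cellIndex ν ρ 1
          simp only [Pi.one_apply, lintegral_const, one_mul] at h1
          rw [← h1]
          exact measure_ne_top _ _
        exact ENNReal.summable_toReal hfin
      refine Summable.of_norm_bounded hsum fun z => ?_
      rw [norm_mul, Real.norm_of_nonneg measureReal_nonneg]
      exact mul_le_mul_of_nonneg_left (hkb _) measureReal_nonneg
    · rw [← integral_map (f := g) (measurable_cellIndex ρ).aemeasurable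
        hgm.aestronglyMeasurable, integral_countable hi]
      simp_rw [e1, smul_eq_mul]
  have hs' : Summable fun z => |g z| :=
    (Equiv.subLeft (cellIndex ρ s)).summable_iff.2 hs
  rw [(key ν₁).2, (key ν₂).2, ← (key ν₁).1.tsum_sub (key ν₂).1, ← Real.norm_eq_abs]
  have he : ∑' w, |k (latticePoint δ w)| = ∑' z, |g z| :=
    ((Equiv.subLeft (cellIndex ρ s)).tsum_eq fun w => |k (latticePoint δ w)|).symm
  rw [he, ← tsum_mul_left]
  refine tsum_of_norm_bounded (hs'.mul_left a).hasSum fun z => ?_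
  rw [← sub_mul, norm_mul]
  exact mul_le_mul_of_nonneg_right (ha z) (abs_nonneg _)

/-- Two finite measures with nearly the same mass in each cell have nearly the same smoothings. -/
lemma abs_integral_sub_integral_le {k : E d → ℝ} (hkm : Measurable k) {M : ℝ}
    (hkb : ∀ v, |k v| ≤ M) {δ h : ℝ} (hδ : 0 < δ) (hh : 0 < h) {ν₁ ν₂ : Measure (E d)}
    [IsFiniteMeasure ν₁] [IsFiniteMeasure ν₂] {A a β : ℝ}
    (hA : ∑' w, cellOsc k δ w ≤ ENNReal.ofReal A) (hA0 : 0 ≤ A)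
    (hs : Summable fun w => |k (latticePoint δ w)|) (ha0 : 0 ≤ a)
    (ha : ∀ z, |ν₁.real (cell (δ * h) z) - ν₂.real (cell (δ * h) z)| ≤ a) (hβ0 : 0 ≤ β)
    (hβ : ∀ z, ν₂.real (cell (δ * h) z) ≤ β) (s : E d) :
    |∫ t, k (h⁻¹ • (s - t)) ∂ν₁ - ∫ t, k (h⁻¹ • (s - t)) ∂ν₂| ≤
      a * (A + ∑' w, |k (latticePoint δ w)|) + 2 * β * A := by
  -- The cells have `ν₁`-mass at most `a + β`, so the three errors add up to `(a + β) A + a ∑ |k| +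
  -- β A`.
  have h1 := abs_integral_sub_integral_comp_cellIndex_le hkm hkb hδ hh ν₁ hA hA0
    (by positivity : 0 ≤ a + β) (fun z => by linarith [hβ z, (abs_le.1 (ha z)).2]) s
  have h2 := abs_integral_sub_integral_comp_cellIndex_le hkm hkb hδ hh ν₂ hA hA0 hβ0 hβ s
  have h3 := abs_integral_comp_cellIndex_sub_le hkb hs ha s
  rw [abs_le] at *
  constructor <;> nlinarith

end Cells

/-! ### Oscillation sums and approximation of the identity. -/

section SmoothingKernel

variable {d : ℕ} {k : E d → ℝ}

lemma IsSmoothingKernel.exists_bound (hk : IsSmoothingKernel k) :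
    ∃ M, 0 ≤ M ∧ ∀ v, |k v| ≤ M := by
  obtain ⟨L, hL, hkL, -⟩ := hk.dominated
  have h : ∀ v, |k v| ≤ L 0 := fun v =>
    (hkL v).trans (hL Set.self_mem_Ici (norm_nonneg v) (norm_nonneg v))
  exact ⟨L 0, (abs_nonneg _).trans (h 0), h⟩

/-- The integral of a non-integrable function is `0` by convention, which contradicts the value one.
-/
lemma IsSmoothingKernel.integrable (hk : IsSmoothingKernel k) : Integrable k := by
  by_contra h
  have := integral_undef h
  rw [hk.integral_eq_one] at this
  exact one_ne_zero this

/-- An integrable function that dominates all nearby values of the kernel. -/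
lemma IsSmoothingKernel.exists_envelope (hk : IsSmoothingKernel k) {r : ℝ} (hr : 0 ≤ r) :
    ∃ D : E d → ℝ, Integrable D ∧ ∀ u v, ‖u - v‖ ≤ r → |k u| ≤ D v := by
  obtain ⟨L, hL, hkL, hLi⟩ := hk.dominated
  have hL0 : ∀ v : E d, 0 ≤ L ‖v‖ := fun v => (abs_nonneg _).trans (hkL v)
  have hL00 : 0 ≤ L 0 := by simpa using hL0 0
  have hle : ∀ u v : E d, ‖u - v‖ ≤ r → |k u| ≤ L (max (‖v‖ - r) 0) := fun u v huv => by
    refine (hkL u).trans (hL (Set.mem_Ici.2 (le_max_right _ _)) (norm_nonneg u) (max_le ?_ (norm_nonneg u)))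
    have := norm_sub_norm_le v u
    rw [norm_sub_rev] at this
    linarith
  refine ⟨fun v => L (max (‖v‖ - r) 0), ?_, hle⟩
  have hmono : Antitone fun x : ℝ => L (max x 0) := fun x y hxy =>
    hL (Set.mem_Ici.2 (le_max_right _ _)) (Set.mem_Ici.2 (le_max_right _ _)) (max_le_max_right 0 hxy)
  have hmeas : Measurable fun v : E d => L (max (‖v‖ - r) 0) :=
    hmono.measurable.comp (by fun_prop : Measurable fun v : E d => ‖v‖ - r)
  -- Outside the ball of radius `2 r` one has `‖v‖ - r ≥ ‖v‖ / 2`, so `L (‖v‖ / 2)` dominates;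
  -- inside it the constant `L 0` does.
  have hi1 : Integrable fun v : E d => L ‖(2 : ℝ)⁻¹ • v‖ :=
    hLi.comp_smul (by norm_num : (2 : ℝ)⁻¹ ≠ 0)
  have hi2 : Integrable ((Metric.closedBall (0 : E d) (2 * r)).indicator fun _ => L 0) :=
    (integrable_indicator_iff Metric.isClosed_closedBall.measurableSet).2
      (integrableOn_const (isCompact_closedBall _ _).measure_lt_top.ne)
  refine (hi1.add hi2).mono' hmeas.aestronglyMeasurable (ae_of_all _ fun v => ?_)
  have hnn : 0 ≤ L (max (‖v‖ - r) 0) := (abs_nonneg _).trans (hle v v (by simpa using hr))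
  rw [Real.norm_of_nonneg hnn]
  simp only [Pi.add_apply]
  by_cases hv : v ∈ Metric.closedBall (0 : E d) (2 * r)
  · rw [Set.indicator_of_mem hv]
    have : L (max (‖v‖ - r) 0) ≤ L 0 := hL Set.self_mem_Ici (Set.mem_Ici.2 (le_max_right _ _)) (le_max_right _ _)
    have h2 := hL0 ((2 : ℝ)⁻¹ • v)
    linarith
  · rw [Set.indicator_of_notMem hv, add_zero]
    rw [mem_closedBall_zero_iff, not_le] at hv
    refine hL (norm_nonneg _) (Set.mem_Ici.2 (le_max_right _ _)) ?_
    rw [norm_smul, Real.norm_of_nonneg (by norm_num)]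
    exact le_max_of_le_left (by linarith)

lemma cellOsc_cellIndex_le {δ : ℝ} (hδ : 0 < δ) {v : E d} {c : ℝ}
    (hc : ∀ u, ‖u - v‖ ≤ 2 * d * δ → |k u| ≤ c) :
    cellOsc k δ (cellIndex δ v) ≤ ENNReal.ofReal (2 * c) := by
  refine iSup₂_le fun u hu => ?_
  have h1 := norm_sub_latticePoint_le hδ v
  rw [mem_closedBall_iff_norm] at hu
  have hd : (0 : ℝ) ≤ d * δ := by positivity
  have h2 : ‖u - v‖ ≤ 2 * d * δ := by
    have := norm_sub_le_norm_sub_add_norm_sub u (latticePoint δ (cellIndex δ v)) v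
    rw [norm_sub_rev (latticePoint δ (cellIndex δ v))] at this
    linarith
  have h3 : ‖latticePoint δ (cellIndex δ v) - v‖ ≤ 2 * d * δ := by
    rw [norm_sub_rev]; linarith
  rw [← ofReal_norm]
  refine ENNReal.ofReal_le_ofReal ((norm_sub_le _ _).trans ?_)
  have := hc _ h2
  have := hc _ h3
  simp only [Real.norm_eq_abs]
  linarith

/-- The oscillation at the corner near `v` only involves points within `2 d δ` of `v`, so it
vanishes in the limit at continuity points of `k`, while the envelope dominates it. This is a form
of Riemann integrability of `k` on the whole space. -/
lemma IsSmoothingKernel.tendsto_lintegral_cellOsc (hk : IsSmoothingKernel k) {δ : ℕ → ℝ}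
    (hδ0 : ∀ p, 0 < δ p) (hδ1 : ∀ p, δ p ≤ 1) (hδ : Tendsto δ atTop (𝓝 0)) :
    Tendsto (fun p => ∫⁻ v, cellOsc k (δ p) (cellIndex (δ p) v)) atTop (𝓝 0) := by
  obtain ⟨D, hDi, hD⟩ := hk.exists_envelope (r := 2 * d) (by positivity)
  have hm : ∀ p, Measurable fun v : E d => cellOsc k (δ p) (cellIndex (δ p) v) := fun p =>
    (Measurable.of_discrete (f := cellOsc k (δ p))).comp (measurable_cellIndex _)
  rw [← lintegral_zero (μ := (volume : Measure (E d)))]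
  refine tendsto_lintegral_of_dominated_convergence (fun v => ENNReal.ofReal (2 * D v)) hm
    (fun p => ae_of_all _ fun v => ?_) ?_ ?_
  · refine cellOsc_cellIndex_le (hδ0 p) fun u hu => hD u v (hu.trans ?_)
    have := hδ1 p
    have hd : (0 : ℝ) ≤ 2 * d := by positivity
    nlinarith
  · exact (hDi.const_mul 2).lintegral_lt_top.ne
  · filter_upwards [hk.ae_continuousAt] with v hv
    rw [ENNReal.tendsto_nhds_zero]
    intro ε hε
    by_cases hεt : ε = ∞
    · simp [hεt]
    have he : 0 < ε.toReal := ENNReal.toReal_pos hε.ne' hεt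
    obtain ⟨η, hη, hηk⟩ := Metric.continuousAt_iff.1 hv (ε.toReal / 2) (by positivity)
    have ht : Tendsto (fun p => 2 * d * δ p) atTop (𝓝 0) := by
      simpa using hδ.const_mul (2 * d : ℝ)
    filter_upwards [ht.eventually_lt_const hη] with p hp
    refine iSup₂_le fun u hu => ?_
    have h1 := norm_sub_latticePoint_le (hδ0 p) v
    rw [mem_closedBall_iff_norm] at hu
    have hd : (0 : ℝ) ≤ d * δ p := by have := hδ0 p; positivity
    have h2 : dist u v < η := by
      rw [dist_eq_norm]
      have := norm_sub_le_norm_sub_add_norm_sub u (latticePoint (δ p) (cellIndex (δ p) v)) v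
      rw [norm_sub_rev (latticePoint (δ p) (cellIndex (δ p) v))] at this
      linarith
    have h3 : dist (latticePoint (δ p) (cellIndex (δ p) v)) v < η := by
      rw [dist_comm, dist_eq_norm]; linarith
    rw [← ofReal_norm, ← ENNReal.ofReal_toReal hεt]
    refine ENNReal.ofReal_le_ofReal ?_
    rw [← dist_eq_norm]
    have := dist_triangle_right (k u) (k (latticePoint (δ p) (cellIndex (δ p) v))) (k v)
    linarith [hηk h2, hηk h3]

lemma IsSmoothingKernel.summable_latticePoint (hk : IsSmoothingKernel k) {δ : ℝ} (hδ0 : 0 < δ)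
    (hδ1 : δ ≤ 1) : Summable fun w => |k (latticePoint δ w)| := by
  obtain ⟨D, hDi, hD⟩ := hk.exists_envelope (r := 2 * d) (by positivity)
  have h1 : (∑' z : Fin d → ℤ, ‖k (latticePoint δ z)‖ₑ) * ENNReal.ofReal (δ ^ d) ≠ ∞ := by
    rw [← lintegral_comp_cellIndex_volume hδ0 fun z => ‖k (latticePoint δ z)‖ₑ]
    refine ((lintegral_mono fun v => ?_).trans_lt hDi.lintegral_lt_top).ne
    rw [← ofReal_norm]
    refine ENNReal.ofReal_le_ofReal (hD _ v ?_)
    rw [norm_sub_rev]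
    refine (norm_sub_latticePoint_le hδ0 v).trans ?_
    have hd : (0 : ℝ) ≤ d := by positivity
    nlinarith
  have h2 : ∑' z : Fin d → ℤ, ‖k (latticePoint δ z)‖ₑ ≠ ∞ := by
    intro h
    rw [h, ENNReal.top_mul (by simpa using pow_pos hδ0 d)] at h1
    exact h1 rfl
  have h3 := ENNReal.summable_toReal h2
  refine h3.congr fun z => ?_
  simp

/-- Uniform approximation of the identity. -/
lemma tendsto_integral_kernel (hki : Integrable k) (hk1 : ∫ v, k v = 1) {f : E d → ℝ}
    (hf : UniformContinuous f) {M : ℝ} (hM : ∀ v, |f v| ≤ M) :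
    Tendsto (fun p : ℝ × E d => (∫ v, k v * f (p.2 - p.1 • v)) - f p.2) (𝓝 0 ×ˢ ⊤) (𝓝 0) := by
  have hint : ∀ p : ℝ × E d, Integrable fun v => k v * f (p.2 - p.1 • v) := fun p =>
    hki.mul_bdd (c := M)
      (hf.continuous.comp (g := f) (f := fun v => p.2 - p.1 • v) (by fun_prop)).aestronglyMeasurable
      (ae_of_all _ fun v => hM _)
  have he : ∀ p : ℝ × E d, (∫ v, k v * f (p.2 - p.1 • v)) - f p.2 =
      ∫ v, k v * (f (p.2 - p.1 • v) - f p.2) := by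
    intro p
    simp_rw [mul_sub]
    rw [integral_sub (hint p) (hki.mul_const _), integral_mul_const, hk1, one_mul]
  simp_rw [he]
  have h0 : 𝓝 (0 : ℝ) = 𝓝 (∫ _v : E d, (0 : ℝ)) := by simp
  conv_rhs => rw [h0]
  -- Dominated convergence is applied along `𝓝 0 ×ˢ ⊤`; leaving the second factor unrestricted makes
  -- the limit uniform in `s`.
  refine tendsto_integral_filter_of_dominated_convergence (fun v => |k v| * (2 * M))
    (Eventually.of_forall fun p => ?_) (Eventually.of_forall fun p => ae_of_all _ fun v => ?_)
    (hki.abs.mul_const _) (ae_of_all _ fun v => ?_)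
  · exact hki.aestronglyMeasurable.mul
      ((hf.continuous.comp (g := f) (f := fun v => p.2 - p.1 • v) (by fun_prop)).sub continuous_const).aestronglyMeasurable
  · rw [norm_mul, Real.norm_eq_abs]
    refine mul_le_mul_of_nonneg_left ?_ (abs_nonneg _)
    refine (norm_sub_le _ _).trans ?_
    have h1 := hM (p.2 - p.1 • v)
    have h2 := hM p.2
    simp only [Real.norm_eq_abs]
    linarith
  · rw [Metric.tendsto_nhds]
    intro ε hε
    have hc : 0 < |k v| + 1 := by positivity
    obtain ⟨η, hη, hηf⟩ := Metric.uniformContinuous_iff.1 hf (ε / (|k v| + 1)) (by positivity)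
    have ht : Tendsto (fun r : ℝ => ‖r • v‖) (𝓝 0) (𝓝 0) := by
      have : Continuous fun r : ℝ => ‖r • v‖ := by fun_prop
      simpa using this.tendsto 0
    filter_upwards [(ht.eventually_lt_const hη).prod_inl ⊤] with p hp
    have h1 := hηf (a := p.2 - p.1 • v) (b := p.2) (by simpa [dist_eq_norm] using hp)
    rw [Real.dist_eq, lt_div_iff₀ hc] at h1
    rw [dist_zero_right, norm_mul, Real.norm_eq_abs, Real.norm_eq_abs]
    nlinarith [abs_nonneg (f (p.2 - p.1 • v) - f p.2)]

lemma integral_kernel_withDensity {f : E d → ℝ} (hf : Measurable f) (hf0 : ∀ v, 0 ≤ f v)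
    {h : ℝ} (hh : 0 < h) (s : E d) :
    ∫ t, k (h⁻¹ • (s - t)) ∂(volume.withDensity fun t => ENNReal.ofReal (f t)) =
      h ^ d * ∫ v, k v * f (s - h • v) := by
  rw [integral_withDensity_eq_integral_toReal_smul (by fun_prop) (by simp)]
  have e1 : ∀ t, (ENNReal.ofReal (f t)).toReal • k (h⁻¹ • (s - t)) =
      (fun t => f (s - t) * k (h⁻¹ • t)) (s - t) := fun t => by
    simp [ENNReal.toReal_ofReal (hf0 t)]
  simp_rw [e1]
  rw [integral_sub_left_eq_self (fun t => f (s - t) * k (h⁻¹ • t)) volume s]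
  have e2 : ∀ t, f (s - t) * k (h⁻¹ • t) = (fun v => k v * f (s - h • v)) (h⁻¹ • t) := fun t => by
    simp [smul_smul, hh.ne', mul_comm]
  rw [integral_congr_ae (ae_of_all _ e2),
    Measure.integral_comp_inv_smul_of_nonneg _ (fun v => k v * f (s - h • v)) hh.le]
  simp

end SmoothingKernel

/-! ### From cell masses to uniform convergence of smoothings. -/

section UniformConvergence

variable {d : ℕ} {k : E d → ℝ}

/-- Only `A δ^d` is made small; `A` itself may be large. Meshes of the form `1 / (p + 1)` are used
so that countably many almost sure events suffice later. -/
lemma IsSmoothingKernel.exists_mesh (hk : IsSmoothingKernel k) {ε : ℝ} (hε : 0 < ε) :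
    ∃ (p : ℕ) (A : ℝ), 0 ≤ A ∧ ∑' w, cellOsc k (1 / ((p : ℝ) + 1)) w ≤ ENNReal.ofReal A ∧
      A * (1 / ((p : ℝ) + 1)) ^ d ≤ ε := by
  have hδ0 : ∀ p : ℕ, 0 < 1 / ((p : ℝ) + 1) := fun p => by positivity
  have hδ1 : ∀ p : ℕ, 1 / ((p : ℝ) + 1) ≤ 1 := fun p => by
    rw [div_le_one (by positivity)]; linarith [(Nat.cast_nonneg p : (0 : ℝ) ≤ p)]
  have h := hk.tendsto_lintegral_cellOsc hδ0 hδ1 tendsto_one_div_add_atTop_nhds_zero_nat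
  obtain ⟨p, hp⟩ := (h.eventually_lt_const (ENNReal.ofReal_pos.2 hε)).exists
  rw [lintegral_comp_cellIndex_volume (hδ0 p)] at hp
  have hfin : ∑' w, cellOsc k (1 / ((p : ℝ) + 1)) w ≠ ∞ := by
    intro h
    rw [h, ENNReal.top_mul (by simpa using pow_pos (hδ0 p) d)] at hp
    exact not_top_lt hp
  refine ⟨p, (∑' w, cellOsc k (1 / ((p : ℝ) + 1)) w).toReal, ENNReal.toReal_nonneg,
    (ENNReal.ofReal_toReal hfin).ge, ?_⟩
  rw [← ENNReal.ofReal_toReal hfin, ← ENNReal.ofReal_mul ENNReal.toReal_nonneg] at hp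
  exact ((ENNReal.ofReal_lt_ofReal_iff hε).1 hp).le

/-- If the masses of the grid cells are close to those of `n f` then the kernel estimators
converge uniformly to `f`. -/
theorem IsSmoothingKernel.eventually_abs_sub_le (hk : IsSmoothingKernel k) {f : E d → ℝ}
    (hf : UniformContinuous f) (hf0 : ∀ v, 0 ≤ f v) {M : ℝ} (hM : ∀ v, f v ≤ M)
    (hfi : Integrable f) {N : ℕ → Measure (E d)} [∀ n, IsFiniteMeasure (N n)] {H : ℕ → ℝ}
    (hH0 : ∀ n, 0 < H n) (hH : Tendsto H atTop (𝓝 0))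
    (hN : ∀ p : ℕ, ∀ η : ℝ, 0 < η → ∀ᶠ n : ℕ in atTop, ∀ z,
      |(N n).real (cell (1 / ((p : ℝ) + 1) * H n) z) -
        n * (volume.withDensity fun t => ENNReal.ofReal (f t)).real
          (cell (1 / ((p : ℝ) + 1) * H n) z)| ≤ η * (n * H n ^ d))
    {ε : ℝ} (hε : 0 < ε) :
    ∀ᶠ n : ℕ in atTop, ∀ s,
      |(n * H n ^ d)⁻¹ * ∫ t, k ((H n)⁻¹ • (s - t)) ∂(N n) - f s| ≤ ε := by
  have hM0 : 0 ≤ M := (hf0 0).trans (hM 0)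
  -- The error splits into three parts of size `ε / 3`: kernel oscillation `2 M A δ^d`, deviation of
  -- the cell masses, and approximation of the identity. The mesh is fixed first, since the
  -- tolerance for the cell masses depends on `A` and `B`.
  obtain ⟨p, A, hA0, hA, hAε⟩ := hk.exists_mesh (ε := ε / (6 * (M + 1))) (by positivity)
  obtain ⟨L, hL0, hL⟩ := hk.exists_bound
  set δ : ℝ := 1 / ((p : ℝ) + 1) with hδ
  have hδ0 : 0 < δ := by positivity
  have hδ1 : δ ≤ 1 := by
    rw [hδ, div_le_one (by positivity)]; linarith [(Nat.cast_nonneg p : (0 : ℝ) ≤ p)]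
  have hs := hk.summable_latticePoint hδ0 hδ1
  set B := ∑' w : Fin d → ℤ, |k (latticePoint δ w)|
  have hB0 : 0 ≤ B := tsum_nonneg fun _ => abs_nonneg _
  set F := volume.withDensity fun t => ENNReal.ofReal (f t) with hF
  have hFfin : IsFiniteMeasure F := isFiniteMeasure_withDensity_ofReal hfi.2
  have hker := tendsto_integral_kernel hk.integrable hk.integral_eq_one hf (M := M)
    fun v => by rw [abs_of_nonneg (hf0 v)]; exact hM v
  have hker' := Metric.tendsto_nhds.1 hker (ε / 3) (by positivity)
  rw [Filter.eventually_prod_iff] at hker'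
  obtain ⟨pa, hpa, pb, hpb, hpab⟩ := hker'
  rw [Filter.eventually_top] at hpb
  filter_upwards [hN p (ε / (3 * (A + B + 1))) (by positivity), hH.eventually hpa,
    eventually_gt_atTop 0] with n hn hpan hn0 s
  have hn0' : (0 : ℝ) < n := by exact_mod_cast hn0
  have hHn := hH0 n
  have hT : 0 < (n : ℝ) * H n ^ d := by positivity
  have hreal : ∀ z, (((n : ℝ≥0) • F : Measure (E d))).real (cell (δ * H n) z) =
      n * F.real (cell (δ * H n) z) := fun z => by
    rw [measureReal_nnreal_smul_apply]; simp
  have hcell : ∀ z, F.real (cell (δ * H n) z) ≤ M * (δ * H n) ^ d := fun z => by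
    have h1 : F (cell (δ * H n) z) ≤ ENNReal.ofReal (M * (δ * H n) ^ d) := by
      rw [hF, withDensity_apply _ (measurableSet_cell _ _), ENNReal.ofReal_mul hM0,
        ← volume_cell (by positivity : 0 < δ * H n) z, ← setLIntegral_const]
      exact lintegral_mono fun t => ENNReal.ofReal_le_ofReal (hM t)
    exact ENNReal.toReal_le_of_le_ofReal (by positivity) h1
  have h1 := abs_integral_sub_integral_le hk.measurable hL hδ0 hHn (ν₁ := N n)
    (ν₂ := (n : ℝ≥0) • F) hA hA0 hs (a := ε / (3 * (A + B + 1)) * (n * H n ^ d))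
    (by positivity) (fun z => by rw [hreal]; exact hn z)
    (β := n * (M * (δ * H n) ^ d)) (by positivity)
    (fun z => by rw [hreal]; exact mul_le_mul_of_nonneg_left (hcell z) hn0'.le) s
  rw [integral_smul_nnreal_measure, hF, integral_kernel_withDensity hf.continuous.measurable hf0 hHn] at h1
  have h2 := hpab hpan (hpb s)
  rw [dist_zero_right, Real.norm_eq_abs] at h2
  simp only at h2
  set I := ∫ v, k v * f (s - H n • v)
  have h3 : (n : ℝ≥0) • (H n ^ d * I) = (n * H n ^ d) * I := by
    rw [NNReal.smul_def, smul_eq_mul]; push_cast; ring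
  rw [h3] at h1
  set J := ∫ t, k ((H n)⁻¹ • (s - t)) ∂(N n)
  have h4 : |(n * H n ^ d)⁻¹ * J - I| ≤ ε / (3 * (A + B + 1)) * (A + B) + 2 * M * (A * δ ^ d) := by
    have e : (n * H n ^ d)⁻¹ * J - I = (n * H n ^ d)⁻¹ * (J - n * H n ^ d * I) := by
      field_simp
    rw [e, abs_mul, abs_of_pos (inv_pos.2 hT), inv_mul_le_iff₀ hT]
    refine h1.trans (le_of_eq ?_)
    rw [mul_pow]; ring
  have h5 : ε / (3 * (A + B + 1)) * (A + B) ≤ ε / 3 := by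
    rw [div_mul_eq_mul_div, div_le_div_iff₀ (by positivity) (by positivity)]
    nlinarith
  have h6 : 2 * M * (A * δ ^ d) ≤ ε / 3 := by
    refine (mul_le_mul_of_nonneg_left hAε (by positivity)).trans ?_
    rw [mul_div_assoc', div_le_div_iff₀ (by positivity) (by positivity)]
    nlinarith
  have h7 := abs_add_le ((n * H n ^ d)⁻¹ * J - I) (I - f s)
  rw [sub_add_sub_cancel] at h7
  linarith

end UniformConvergence

/-! ### Storm intensity and two-sided bounds for the extremal field. -/

section Storms

variable {d : ℕ} {C R μ y₀ : ℝ} {PX : Measure C(E d, ℝ)} {ψ : C(E d, ℝ)} {K : Set (E d)}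
  {y : E d → ℝ≥0∞}

/-- The almost sure properties of a storm shape: it is bounded by `C`, positive on the open ball of
radius `R` and vanishes outside of the closed ball. -/
structure IsShape (C R : ℝ) (X : C(E d, ℝ)) : Prop where
  nonneg : ∀ s, 0 ≤ X s
  le : ∀ s, X s ≤ C
  eq_zero : ∀ s, R < ‖s‖ → X s = 0
  pos : ∀ s, ‖s‖ < R → 0 < X s

lemma ae_isShape (hC : 0 < C) (h1 : ∀ᵐ X ∂PX, ∀ s, 0 ≤ X s)
    (h2 : ∀ᵐ X ∂PX, ∀ s, X s ≤ C * (Metric.closedBall (0 : E d) R).indicator 1 s)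
    (h3 : ∀ᵐ X ∂PX, ∀ s : E d, ‖s‖ < R → 0 < X s) : ∀ᵐ X ∂PX, IsShape C R X := by
  filter_upwards [h1, h2, h3] with X hX1 hX2 hX3
  refine ⟨hX1, fun s => (hX2 s).trans ?_, fun s hs => le_antisymm ((hX2 s).trans ?_) (hX1 s), hX3⟩
  · by_cases hs : s ∈ Metric.closedBall (0 : E d) R <;> simp [hs, hC.le]
  · simp [not_le.2 hs]

/-- The measure `u⁻² du` on `(0, ∞)`. -/
def severityMeasure : Measure ℝ :=
  (volume.restrict (Set.Ioi (0 : ℝ))).withDensity fun u => ENNReal.ofReal (u ^ 2)⁻¹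

instance : SFinite severityMeasure := by unfold severityMeasure; infer_instance

lemma severityMeasure_Ici {a : ℝ} (ha : 0 < a) :
    severityMeasure (Set.Ici a) = ENNReal.ofReal a⁻¹ := by
  have h0 : Set.Ici a ∩ Set.Ioi 0 = Set.Ici a :=
    Set.inter_eq_left.2 fun u hu => ha.trans_le hu
  rw [severityMeasure, withDensity_apply _ measurableSet_Ici,
    Measure.restrict_restrict measurableSet_Ici, h0, setLIntegral_congr Ioi_ae_eq_Ici.symm]
  have e : ∀ u ∈ Set.Ioi a, ENNReal.ofReal (u ^ 2)⁻¹ = ENNReal.ofReal (u ^ (-2 : ℝ)) :=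
    fun u hu => by
      have : 0 ≤ u := (ha.trans hu).le
      rw [Real.rpow_neg this]; norm_num
  rw [setLIntegral_congr_fun measurableSet_Ioi e,
    ← ofReal_integral_eq_lintegral_ofReal (integrableOn_Ioi_rpow_of_lt (by norm_num) ha),
    integral_Ioi_rpow_of_lt (by norm_num) ha]
  · congr 1
    norm_num
    rw [Real.rpow_neg_one]
  · refine (ae_restrict_iff' measurableSet_Ioi).2 (ae_of_all _ fun u hu => ?_)
    exact Real.rpow_nonneg (ha.trans hu).le _

lemma ae_severityMeasure_pos : ∀ᵐ u ∂severityMeasure, 0 < u := by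
  refine (withDensity_absolutelyContinuous _ _).ae_le ?_
  exact ae_restrict_mem measurableSet_Ioi

/-- The severities that exceed a given threshold. -/
lemma severityMeasure_setOf_inv_le {r : ℝ≥0∞} (hr : r ≠ ∞) :
    severityMeasure {u | (ENNReal.ofReal u)⁻¹ ≤ r} = r := by
  rcases eq_or_ne r 0 with rfl | h0
  · have : {u | (ENNReal.ofReal u)⁻¹ ≤ 0} = ∅ := by ext u; simp
    rw [this, measure_empty]
  · have hp : 0 < r.toReal := ENNReal.toReal_pos h0 hr
    have : {u | (ENNReal.ofReal u)⁻¹ ≤ r} = Set.Ici r.toReal⁻¹ := by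
      ext u
      rw [Set.mem_ofPred_eq, Set.mem_Ici, ENNReal.inv_le_iff_inv_le,
        ← ENNReal.ofReal_toReal (ENNReal.inv_ne_top.2 h0), ENNReal.toReal_inv]
      rcases le_or_gt u 0 with hu | hu
      · rw [ENNReal.ofReal_of_nonpos hu]
        have : 0 < r.toReal⁻¹ := inv_pos.2 hp
        simp only [nonpos_iff_eq_zero, ENNReal.ofReal_eq_zero]
        constructor <;> intro <;> linarith
      · exact ENNReal.ofReal_le_ofReal_iff hu.le
    rw [this, severityMeasure_Ici (inv_pos.2 hp), inv_inv, ENNReal.ofReal_toReal hr]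

/-- The severity is integrated innermost because, for a given centre and shape, retention is a
threshold condition on `u` alone. -/
lemma stormIntensity_apply [SFinite PX] {S : Set (Storm d)} (hS : MeasurableSet S) :
    stormIntensity μ PX ψ S = ENNReal.ofReal μ⁻¹ * ∫⁻ s, ENNReal.ofReal (ψ s) *
      ∫⁻ X, severityMeasure {u | (s, u, X) ∈ S} ∂PX := by
  have hψ : Measurable fun s : E d => ENNReal.ofReal (ψ s) := by fun_prop
  rw [stormIntensity, Measure.smul_apply, smul_eq_mul, ← severityMeasure, Measure.prod_apply hS,
    lintegral_withDensity_eq_lintegral_mul _ hψ (measurable_measure_prodMk_left hS)]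
  congr 1
  refine lintegral_congr fun s => ?_
  simp only [Pi.mul_apply]
  rw [Measure.prod_apply_symm (measurable_prodMk_left hS)]
  rfl

lemma stormIntensity_prod [IsProbabilityMeasure PX] {A : Set (E d)} (hA : MeasurableSet A) {a : ℝ}
    (ha : 0 < a) :
    stormIntensity μ PX ψ (A ×ˢ (Set.Ici a ×ˢ Set.univ)) =
      ENNReal.ofReal μ⁻¹ * ((∫⁻ s in A, ENNReal.ofReal (ψ s)) * ENNReal.ofReal a⁻¹) := by
  rw [stormIntensity, Measure.smul_apply, smul_eq_mul, ← severityMeasure, Measure.prod_prod,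
    Measure.prod_prod, severityMeasure_Ici ha, measure_univ, mul_one, withDensity_apply _ hA]

lemma ae_stormIntensity [IsProbabilityMeasure PX] (h : ∀ᵐ X ∂PX, IsShape C R X) :
    ∀ᵐ p ∂(stormIntensity μ PX ψ), 0 < p.2.1 ∧ IsShape C R p.2.2 := by
  rw [stormIntensity, ← severityMeasure]
  refine Measure.ae_smul_measure ?_ _
  have h1 : ∀ᵐ q ∂(severityMeasure.prod PX), 0 < q.1 ∧ IsShape C R q.2 := by
    filter_upwards [Measure.quasiMeasurePreserving_fst.ae ae_severityMeasure_pos,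
      Measure.quasiMeasurePreserving_snd.ae h] with q hq1 hq2 using ⟨hq1, hq2⟩
  exact Measure.quasiMeasurePreserving_snd.ae h1

lemma setLIntegral_ofReal_lt_top {A : Set (E d)} (hA : Bornology.IsBounded A) :
    ∫⁻ s in A, ENNReal.ofReal (ψ s) < ∞ := by
  have h : IntegrableOn ψ (closure A) :=
    ψ.continuous.continuousOn.integrableOn_compact hA.isCompact_closure
  exact (h.mono_set subset_closure).lintegral_lt_top

/-- The extremal field is almost surely bounded on compact sets. -/
lemma IsPoissonProcess.ae_extremalField_le [IsProbabilityMeasure PX] {Ω : Type*}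
    [MeasurableSpace Ω] {P : Measure Ω} [IsProbabilityMeasure P] {x : ℕ → Ω → Storm d}
    (hx : IsPoissonProcess P x (stormIntensity μ PX ψ)) (hC : 0 < C)
    (hX : ∀ᵐ X ∂PX, IsShape C R X) (hK : IsCompact K) :
    ∀ᵐ ω ∂P, ∃ M : ℝ, ∀ t ∈ K, extremalField (fun i => x i ω) t ≤ ENNReal.ofReal M := by
  -- Only storms centred in `A` reach `K`. Finitely many of them have severity at least `1`; every
  -- other storm contributes at most `C`.
  set A := K + Metric.closedBall (0 : E d) R
  have hAc : IsCompact A := hK.add (isCompact_closedBall _ _)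
  have hAm : MeasurableSet A := hAc.isClosed.measurableSet
  have hfin : stormIntensity μ PX ψ (A ×ˢ (Set.Ici 1 ×ˢ Set.univ)) < ∞ := by
    rw [stormIntensity_prod hAm one_pos]
    exact ENNReal.mul_lt_top ENNReal.ofReal_lt_top
      (ENNReal.mul_lt_top (setLIntegral_ofReal_lt_top hAc.isBounded) ENNReal.ofReal_lt_top)
  filter_upwards [hx.ae_finite (hAm.prod (measurableSet_Ici.prod MeasurableSet.univ)) hfin,
    hx.ae_of_ae (ae_stormIntensity hX)] with ω hω hgood
  refine ⟨C + ∑ i ∈ hω.toFinset, (x i ω).2.1 * C, fun t ht => iSup_le fun i => ?_⟩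
  obtain ⟨hu, hs⟩ := hgood i
  have hsum : 0 ≤ ∑ i ∈ hω.toFinset, (x i ω).2.1 * C :=
    Finset.sum_nonneg fun j _ => mul_nonneg (hgood j).1.le hC.le
  refine ENNReal.ofReal_le_ofReal ?_
  by_cases hR : R < ‖t - (x i ω).1‖
  · rw [hs.eq_zero _ hR, mul_zero]
    positivity
  have h1 : (x i ω).2.1 * (x i ω).2.2 (t - (x i ω).1) ≤ (x i ω).2.1 * C :=
    mul_le_mul_of_nonneg_left (hs.le _) hu.le
  refine h1.trans ?_
  by_cases hu1 : (x i ω).2.1 ≤ 1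
  · nlinarith
  · have hmem : i ∈ hω.toFinset := by
      rw [Set.Finite.mem_toFinset]
      refine ⟨⟨t, ht, (x i ω).1 - t, ?_, by simp⟩, (not_le.1 hu1).le, trivial⟩
      rw [mem_closedBall_zero_iff, norm_sub_rev]
      exact not_lt.1 hR
    have := Finset.single_le_sum (f := fun i => (x i ω).2.1 * C)
      (fun j _ => mul_nonneg (hgood j).1.le hC.le) hmem
    linarith

/-- The extremal field is almost surely bounded away from zero on compact sets. -/
lemma IsPoissonProcess.ae_le_extremalField [IsProbabilityMeasure PX] {Ω : Type*}
    [MeasurableSpace Ω] {P : Measure Ω} [IsProbabilityMeasure P] {x : ℕ → Ω → Storm d}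
    (hx : IsPoissonProcess P x (stormIntensity μ PX ψ)) (hμ : 0 < μ) (hR : 0 < R)
    (hψ : ∀ s, 0 < ψ s) (hX : ∀ᵐ X ∂PX, IsShape C R X) (hK : IsCompact K) :
    ∀ᵐ ω ∂P, ∃ y₀ : ℝ, 0 < y₀ ∧
      ∀ t ∈ K, ENNReal.ofReal y₀ ≤ extremalField (fun i => x i ω) t := by
  -- If `t` and a storm centre share a ball of radius `R / 4`, they are less than `R / 2` apart, and
  -- the shape has a positive minimum on the closed ball of radius `R / 2`.
  have hR4 : 0 < R / 4 := by positivity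
  obtain ⟨T, -, hTf, hT⟩ := hK.finite_cover_balls hR4
  have hone : ∀ a : E d, ∀ᵐ ω ∂P, ∃ i, (x i ω).1 ∈ Metric.ball a (R / 4) := by
    intro a
    -- As the severity threshold `1 / (n + 1)` decreases, the mass grows like `n + 1`, so some storm
    -- is almost surely centred in the ball.
    have hval : ∀ n : ℕ, stormIntensity μ PX ψ
        (Metric.ball a (R / 4) ×ˢ (Set.Ici (1 / ((n : ℝ) + 1)) ×ˢ Set.univ)) =
        ENNReal.ofReal μ⁻¹ * ((∫⁻ s in Metric.ball a (R / 4), ENNReal.ofReal (ψ s)) *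
          ENNReal.ofReal ((n : ℝ) + 1)) := fun n => by
      rw [stormIntensity_prod measurableSet_ball (by positivity)]; simp
    set J := ∫⁻ s in Metric.ball a (R / 4), ENNReal.ofReal (ψ s)
    have hJ : J ≠ ∞ := (setLIntegral_ofReal_lt_top Metric.isBounded_ball).ne
    have hJ0 : 0 < J := by
      refine (setLIntegral_pos_iff (by fun_prop)).2 ?_
      have : Function.support (fun s : E d => ENNReal.ofReal (ψ s)) = Set.univ := by
        ext s; simp [hψ s]
      rw [this, Set.univ_inter]
      exact Metric.measure_ball_pos _ _ hR4
    have := hx.ae_exists_mem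
      (B := fun n : ℕ => Metric.ball a (R / 4) ×ˢ (Set.Ici (1 / ((n : ℝ) + 1)) ×ˢ Set.univ))
      (fun n => measurableSet_ball.prod (measurableSet_Ici.prod MeasurableSet.univ))
      (fun n => by
        rw [hval]
        exact ENNReal.mul_lt_top ENNReal.ofReal_lt_top
          (ENNReal.mul_lt_top hJ.lt_top ENNReal.ofReal_lt_top)) ?_
    · filter_upwards [this] with ω ⟨n, i, hi⟩ using ⟨i, hi.1⟩
    · have e : ∀ n : ℕ, (stormIntensity μ PX ψ
          (Metric.ball a (R / 4) ×ˢ (Set.Ici (1 / ((n : ℝ) + 1)) ×ˢ Set.univ))).toReal =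
          (μ⁻¹ * J.toReal) * ((n : ℝ) + 1) := fun n => by
        rw [hval, ENNReal.toReal_mul, ENNReal.toReal_mul, ENNReal.toReal_ofReal (by positivity),
          ENNReal.toReal_ofReal (by positivity), mul_assoc]
      simp_rw [e]
      have hJr : 0 < J.toReal := ENNReal.toReal_pos hJ0.ne' hJ
      refine Tendsto.const_mul_atTop (by positivity) ?_
      exact tendsto_atTop_add_const_right _ _ tendsto_natCast_atTop_atTop
  have hall : ∀ᵐ ω ∂P, ∀ a ∈ T, ∃ i, (x i ω).1 ∈ Metric.ball a (R / 4) :=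
    (ae_ball_iff hTf.countable).2 fun a _ => hone a
  filter_upwards [hall, hx.ae_of_ae (ae_stormIntensity hX)] with ω hω hgood
  have hloc : ∀ a ∈ T, ∃ c : ℝ, 0 < c ∧ ∀ t ∈ Metric.ball a (R / 4),
      ENNReal.ofReal c ≤ extremalField (fun i => x i ω) t := by
    intro a ha
    obtain ⟨i, hi⟩ := hω a ha
    obtain ⟨v, hv, hmin⟩ := (isCompact_closedBall (0 : E d) (R / 2)).exists_isMinOn
      ⟨0, by simp; positivity⟩ (x i ω).2.2.continuous.continuousOn
    rw [mem_closedBall_zero_iff] at hv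
    refine ⟨(x i ω).2.1 * (x i ω).2.2 v,
      mul_pos (hgood i).1 ((hgood i).2.pos v (by linarith)), fun t ht => ?_⟩
    refine le_iSup_of_le i (ENNReal.ofReal_le_ofReal ?_)
    refine mul_le_mul_of_nonneg_left (hmin ?_) (hgood i).1.le
    rw [mem_closedBall_zero_iff, ← dist_eq_norm]
    rw [Metric.mem_ball] at hi ht
    have := dist_triangle_right t (x i ω).1 a
    linarith
  choose! c hc hcl using hloc
  obtain ⟨y₀, hy₀, hle⟩ : ∃ y₀ : ℝ, 0 < y₀ ∧ ∀ a ∈ T, y₀ ≤ c a := by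
    rcases T.eq_empty_or_nonempty with h | h
    · exact ⟨1, one_pos, by simp [h]⟩
    · obtain ⟨a, ha, hmin⟩ := Set.exists_min_image T c hTf h
      exact ⟨c a, hc a ha, hmin⟩
  refine ⟨y₀, hy₀, fun t ht => ?_⟩
  obtain ⟨a, ha, hta⟩ := Set.mem_iUnion₂.1 (hT ht)
  exact (ENNReal.ofReal_le_ofReal (hle a ha)).trans (hcl a ha t hta)

end Storms

/-! ### Retained storms and the regularity of their intensity. -/

section Retention

variable {d : ℕ} {C R μ y₀ M : ℝ} {PX : Measure C(E d, ℝ)} {ψ : C(E d, ℝ)} {K : Set (E d)}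
  {y : E d → ℝ≥0∞}

/-- A supremum of continuous functions, even an uncountable one, is lower semicontinuous. No
regularity of `y` is needed; its lower bound makes division by `y t` continuous. -/
lemma measurable_supRatio (hy₀ : 0 < y₀) (hy : ∀ t ∈ K, ENNReal.ofReal y₀ ≤ y t) :
    Measurable fun p : E d × C(E d, ℝ) => supRatio K y p.1 p.2 := by
  refine LowerSemicontinuous.measurable (lowerSemicontinuous_biSup fun t ht => ?_)
  have h0 : y t ≠ 0 := ((ENNReal.ofReal_pos.2 hy₀).trans_le (hy t ht)).ne'
  have hev : Continuous fun p : E d × C(E d, ℝ) => p.2 (t - p.1) := by fun_prop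
  exact ((ENNReal.continuous_div_const _ h0).comp
    (ENNReal.continuous_ofReal.comp hev)).lowerSemicontinuous

lemma measurable_supRatio_right (hy₀ : 0 < y₀) (hy : ∀ t ∈ K, ENNReal.ofReal y₀ ≤ y t) (s : E d) :
    Measurable (supRatio K y s) := by
  have h := measurable_supRatio hy₀ hy
  have h2 : Measurable (fun X : C(E d, ℝ) => (s, X)) := measurable_prodMk_left
  have h3 := h.comp h2
  exact h3

lemma measurableSet_contributes (hy₀ : 0 < y₀) (hy : ∀ t ∈ K, ENNReal.ofReal y₀ ≤ y t) :
    MeasurableSet {p : Storm d | Contributes K y p} := by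
  have h1 : Measurable fun p : Storm d => (ENNReal.ofReal p.2.1)⁻¹ :=
    (ENNReal.measurable_ofReal.comp (measurable_fst.comp measurable_snd)).inv
  have h2 : Measurable fun p : Storm d => (p.1, p.2.2) :=
    measurable_fst.prodMk (measurable_snd.comp measurable_snd)
  have h := measurable_supRatio hy₀ hy
  have h3 := h.comp h2
  exact measurableSet_le h1 h3

lemma supRatio_le (hy₀ : 0 < y₀) (hy : ∀ t ∈ K, ENNReal.ofReal y₀ ≤ y t) {X : C(E d, ℝ)}
    (hX : IsShape C R X) (s : E d) : supRatio K y s X ≤ ENNReal.ofReal (C / y₀) := by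
  rw [ENNReal.ofReal_div_of_pos hy₀]
  exact iSup₂_le fun t ht => ENNReal.div_le_div (ENNReal.ofReal_le_ofReal (hX.le _)) (hy t ht)

lemma supRatio_eq_zero {X : C(E d, ℝ)} (hX : IsShape C R X) {s : E d}
    (hs : s ∉ K + Metric.closedBall (0 : E d) R) : supRatio K y s X = 0 := by
  refine le_antisymm (iSup₂_le fun t ht => ?_) zero_le
  rw [hX.eq_zero, ENNReal.ofReal_zero, ENNReal.zero_div]
  by_contra h
  refine hs ⟨t, ht, s - t, ?_, by simp⟩
  rw [mem_closedBall_zero_iff, norm_sub_rev]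
  exact not_lt.1 h

lemma supRatio_pos (hyM : ∀ t ∈ K, y t ≤ ENNReal.ofReal M) {X : C(E d, ℝ)} (hX : IsShape C R X)
    {s t : E d} (ht : t ∈ K) (hst : ‖t - s‖ < R) : 0 < supRatio K y s X := by
  refine lt_of_lt_of_le ?_ (le_iSup₂ t ht)
  exact ENNReal.div_pos (ENNReal.ofReal_pos.2 (hX.pos _ hst)).ne'
    ((hyM t ht).trans_lt ENNReal.ofReal_lt_top).ne

lemma IsShape.uniformContinuous {X : C(E d, ℝ)} (hX : IsShape C R X) : UniformContinuous X := by
  refine HasCompactSupport.uniformContinuous_of_continuous ?_ X.continuous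
  refine HasCompactSupport.intro (isCompact_closedBall (0 : E d) R) fun s hs => hX.eq_zero s ?_
  simpa using hs

/-- A shape has compact support, so it is uniformly continuous, and its modulus divided by `y₀`
passes through the supremum. -/
lemma continuous_supRatio (hy₀ : 0 < y₀) (hy : ∀ t ∈ K, ENNReal.ofReal y₀ ≤ y t) {X : C(E d, ℝ)}
    (hX : IsShape C R X) : Continuous fun s => supRatio K y s X := by
  rw [continuous_iff_continuousAt]
  intro s
  rw [ContinuousAt, ENNReal.tendsto_nhds
    ((supRatio_le hy₀ hy hX s).trans_lt ENNReal.ofReal_lt_top).ne]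
  intro ε hε
  by_cases hεt : ε = ∞
  · simp [hεt]
  have he : 0 < ε.toReal := ENNReal.toReal_pos hε.ne' hεt
  obtain ⟨η, hη, hηX⟩ := Metric.uniformContinuous_iff.1 hX.uniformContinuous (ε.toReal * y₀)
    (by positivity)
  have key : ∀ a b : E d, dist a b < η → supRatio K y a X ≤ supRatio K y b X + ε := by
    intro a b hab
    refine iSup₂_le fun t ht => ?_
    have h1 : dist (X (t - a)) (X (t - b)) < ε.toReal * y₀ := hηX (by rwa [dist_sub_left])
    have h2 : X (t - a) ≤ X (t - b) + ε.toReal * y₀ := by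
      rw [Real.dist_eq] at h1; linarith [(abs_lt.1 h1).2]
    calc ENNReal.ofReal (X (t - a)) / y t
        ≤ (ENNReal.ofReal (X (t - b)) + ENNReal.ofReal (ε.toReal * y₀)) / y t := by
          gcongr
          exact (ENNReal.ofReal_le_ofReal h2).trans ENNReal.ofReal_add_le
      _ = ENNReal.ofReal (X (t - b)) / y t + ENNReal.ofReal (ε.toReal * y₀) / y t :=
          ENNReal.add_div
      _ ≤ supRatio K y b X + ε := by
          refine add_le_add (le_iSup₂_of_le t ht le_rfl) ?_
          refine (ENNReal.div_le_div_left (hy t ht) _).trans ?_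
          rw [← ENNReal.ofReal_div_of_pos hy₀, mul_div_cancel_right₀ _ hy₀.ne',
            ENNReal.ofReal_toReal hεt]
  filter_upwards [Metric.ball_mem_nhds s hη] with a ha
  rw [Metric.mem_ball] at ha
  refine ⟨?_, key a s ha⟩
  rw [tsub_le_iff_right]
  exact key s a (by rwa [dist_comm])

lemma bFactor_le [IsProbabilityMeasure PX] (hy₀ : 0 < y₀)
    (hy : ∀ t ∈ K, ENNReal.ofReal y₀ ≤ y t) (hX : ∀ᵐ X ∂PX, IsShape C R X) (s : E d) :
    bFactor μ PX K y s ≤ ENNReal.ofReal μ⁻¹ * ENNReal.ofReal (C / y₀) := by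
  refine mul_le_mul_right ?_ _
  refine (lintegral_mono_ae (g := fun _ => ENNReal.ofReal (C / y₀)) ?_).trans (by simp)
  filter_upwards [hX] with X hX using supRatio_le hy₀ hy hX s

lemma bFactor_ne_top [IsProbabilityMeasure PX] (hy₀ : 0 < y₀)
    (hy : ∀ t ∈ K, ENNReal.ofReal y₀ ≤ y t) (hX : ∀ᵐ X ∂PX, IsShape C R X) (s : E d) :
    bFactor μ PX K y s ≠ ∞ :=
  ((bFactor_le hy₀ hy hX s).trans_lt
    (ENNReal.mul_lt_top ENNReal.ofReal_lt_top ENNReal.ofReal_lt_top)).ne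

lemma bFactor_eq_zero (hX : ∀ᵐ X ∂PX, IsShape C R X) {s : E d}
    (hs : s ∉ K + Metric.closedBall (0 : E d) R) : bFactor μ PX K y s = 0 := by
  rw [bFactor, lintegral_congr_ae (g := fun _ => 0), lintegral_zero, mul_zero]
  filter_upwards [hX] with X hX using supRatio_eq_zero hX hs

lemma continuous_bFactor [IsProbabilityMeasure PX] (hy₀ : 0 < y₀)
    (hy : ∀ t ∈ K, ENNReal.ofReal y₀ ≤ y t) (hX : ∀ᵐ X ∂PX, IsShape C R X) :
    Continuous fun s => bFactor μ PX K y s := by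
  refine (ENNReal.continuous_const_mul ENNReal.ofReal_ne_top).comp ?_
  rw [continuous_iff_continuousAt]
  intro s
  refine tendsto_lintegral_filter_of_dominated_convergence (fun _ => ENNReal.ofReal (C / y₀))
    (Eventually.of_forall fun a => measurable_supRatio_right hy₀ hy a)
    (Eventually.of_forall fun a => ?_) (by simp) ?_
  · filter_upwards [hX] with X hX using supRatio_le hy₀ hy hX a
  · filter_upwards [hX] with X hX using (continuous_supRatio hy₀ hy hX).continuousAt

/-- Almost every shape is positive at `t - s` and `y t` is finite, so the integrand is positive
almost everywhere. -/
lemma bFactor_pos [IsProbabilityMeasure PX] (hμ : 0 < μ) (hy₀ : 0 < y₀)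
    (hy : ∀ t ∈ K, ENNReal.ofReal y₀ ≤ y t) (hyM : ∀ t ∈ K, y t ≤ ENNReal.ofReal M)
    (hX : ∀ᵐ X ∂PX, IsShape C R X) {s t : E d} (ht : t ∈ K) (hst : ‖t - s‖ < R) :
    0 < bFactor μ PX K y s := by
  refine ENNReal.mul_pos (ENNReal.ofReal_pos.2 (inv_pos.2 hμ)).ne' fun h0 => ?_
  rw [lintegral_eq_zero_iff (measurable_supRatio_right hy₀ hy s)] at h0
  have : ∀ᵐ X ∂PX, False := by
    filter_upwards [h0, hX] with X h1 h2
    exact (supRatio_pos hyM h2 ht hst).ne' h1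
  exact this.exists.elim fun _ h => h

/-- The intensity `b_K^y(s) ψ(s)` of the centres of the retained storms. -/
def retainedIntensity (μ : ℝ) (PX : Measure C(E d, ℝ)) (ψ : C(E d, ℝ)) (K : Set (E d))
    (y : E d → ℝ≥0∞) (s : E d) : ℝ :=
  (bFactor μ PX K y s).toReal * ψ s

variable [IsProbabilityMeasure PX]

lemma ofReal_retainedIntensity (hy₀ : 0 < y₀) (hy : ∀ t ∈ K, ENNReal.ofReal y₀ ≤ y t)
    (hX : ∀ᵐ X ∂PX, IsShape C R X) (s : E d) :
    ENNReal.ofReal (retainedIntensity μ PX ψ K y s) =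
      bFactor μ PX K y s * ENNReal.ofReal (ψ s) := by
  rw [retainedIntensity, ENNReal.ofReal_mul ENNReal.toReal_nonneg,
    ENNReal.ofReal_toReal (bFactor_ne_top hy₀ hy hX s)]

/-- For a given centre and shape, the severities that ensure retention have mass exactly `supRatio`;
averaging over the shape produces `b`. -/
lemma stormIntensity_retained (hy₀ : 0 < y₀) (hy : ∀ t ∈ K, ENNReal.ofReal y₀ ≤ y t)
    (hX : ∀ᵐ X ∂PX, IsShape C R X) {A : Set (E d)} (hA : MeasurableSet A) :
    stormIntensity μ PX ψ ({p | Contributes K y p} ∩ Prod.fst ⁻¹' A) =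
      (volume.withDensity fun s => ENNReal.ofReal (retainedIntensity μ PX ψ K y s)) A := by
  rw [stormIntensity_apply ((measurableSet_contributes hy₀ hy).inter (measurable_fst hA)),
    withDensity_apply _ hA, ← lintegral_indicator hA, ← lintegral_const_mul']
  swap
  · exact ENNReal.ofReal_ne_top
  refine lintegral_congr fun s => ?_
  by_cases hs : s ∈ A
  · rw [Set.indicator_of_mem hs, ofReal_retainedIntensity hy₀ hy hX, bFactor]
    have : ∫⁻ X, severityMeasure {u | (s, u, X) ∈ {p | Contributes K y p} ∩ Prod.fst ⁻¹' A} ∂PX =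
        ∫⁻ X, supRatio K y s X ∂PX := by
      refine lintegral_congr_ae ?_
      filter_upwards [hX] with X hX
      rw [← severityMeasure_setOf_inv_le
        ((supRatio_le hy₀ hy hX s).trans_lt ENNReal.ofReal_lt_top).ne]
      congr 1
      ext u
      simp [Contributes, hs]
    rw [this]
    ring
  · rw [Set.indicator_of_notMem hs]
    simp [hs]

lemma continuous_retainedIntensity (hy₀ : 0 < y₀) (hy : ∀ t ∈ K, ENNReal.ofReal y₀ ≤ y t)
    (hX : ∀ᵐ X ∂PX, IsShape C R X) : Continuous (retainedIntensity μ PX ψ K y) := by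
  refine Continuous.mul ?_ ψ.continuous
  exact ENNReal.continuousOn_toReal.comp_continuous (continuous_bFactor hy₀ hy hX)
    fun s => bFactor_ne_top hy₀ hy hX s

omit [IsProbabilityMeasure PX] in
lemma retainedIntensity_eq_zero (hX : ∀ᵐ X ∂PX, IsShape C R X) {s : E d}
    (hs : s ∉ K + Metric.closedBall (0 : E d) R) : retainedIntensity μ PX ψ K y s = 0 := by
  rw [retainedIntensity, bFactor_eq_zero hX hs, ENNReal.toReal_zero, zero_mul]

omit [IsProbabilityMeasure PX] in
lemma retainedIntensity_nonneg (hψ : ∀ s, 0 < ψ s) (s : E d) :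
    0 ≤ retainedIntensity μ PX ψ K y s :=
  mul_nonneg ENNReal.toReal_nonneg (hψ s).le

omit [IsProbabilityMeasure PX] in
lemma hasCompactSupport_retainedIntensity (hX : ∀ᵐ X ∂PX, IsShape C R X) (hK : IsCompact K) :
    HasCompactSupport (retainedIntensity μ PX ψ K y) :=
  HasCompactSupport.intro (hK.add (isCompact_closedBall (0 : E d) R))
    fun _ hs => retainedIntensity_eq_zero hX hs

lemma cConst_eq_integral (hψ : ∀ s, 0 < ψ s) (hy₀ : 0 < y₀)
    (hy : ∀ t ∈ K, ENNReal.ofReal y₀ ≤ y t) (hX : ∀ᵐ X ∂PX, IsShape C R X) :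
    cConst μ PX ψ K y = ∫ s, retainedIntensity μ PX ψ K y s := by
  rw [integral_eq_lintegral_of_nonneg_ae (ae_of_all _ (retainedIntensity_nonneg hψ))
    (continuous_retainedIntensity hy₀ hy hX).aestronglyMeasurable, cConst]
  simp_rw [ofReal_retainedIntensity hy₀ hy hX]

lemma cConst_pos (hμ : 0 < μ) (hR : 0 < R) (hψ : ∀ s, 0 < ψ s) (hy₀ : 0 < y₀)
    (hy : ∀ t ∈ K, ENNReal.ofReal y₀ ≤ y t) (hyM : ∀ t ∈ K, y t ≤ ENNReal.ofReal M)
    (hX : ∀ᵐ X ∂PX, IsShape C R X) (hK : IsCompact K) (hne : K.Nonempty) :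
    0 < cConst μ PX ψ K y := by
  rw [cConst_eq_integral hψ hy₀ hy hX]
  obtain ⟨t, ht⟩ := hne
  refine (continuous_retainedIntensity hy₀ hy hX).integral_pos_of_hasCompactSupport_nonneg_nonzero
    (hasCompactSupport_retainedIntensity hX hK) (retainedIntensity_nonneg hψ) (x := t) ?_
  exact (mul_pos (ENNReal.toReal_pos (bFactor_pos hμ hy₀ hy hyM hX ht (by simpa using hR)).ne'
    (bFactor_ne_top hy₀ hy hX t)) (hψ t)).ne'

end Retention

/-! ### Number of cells, deviation bounds, Borel–Cantelli. -/

section GridCounts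

variable {d : ℕ}

/-- The indices of the cells of mesh `ρ` that may meet the ball of radius `r`. -/
def gridIndex (d : ℕ) (r ρ : ℝ) : Finset (Fin d → ℤ) :=
  Finset.Icc (fun _ => -⌈r / ρ⌉) fun _ => ⌈r / ρ⌉

lemma mem_gridIndex {r ρ : ℝ} (hρ : 0 < ρ) {t : E d} (ht : ‖t‖ ≤ r) :
    cellIndex ρ t ∈ gridIndex d r ρ := by
  have h : ∀ i, |t i / ρ| ≤ r / ρ := fun i => by
    rw [abs_div, abs_of_pos hρ]
    have := (PiLp.norm_apply_le t i).trans ht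
    rw [Real.norm_eq_abs] at this
    gcongr
  rw [gridIndex, Finset.mem_Icc]
  constructor <;> intro i
  · refine Int.le_floor.2 ?_
    push_cast
    linarith [(abs_le.1 (h i)).1, Int.le_ceil (r / ρ)]
  · have h1 := Int.floor_le (t i / ρ)
    have : ((cellIndex ρ t i : ℤ) : ℝ) ≤ (⌈r / ρ⌉ : ℤ) :=
      h1.trans ((abs_le.1 (h i)).2.trans (Int.le_ceil _))
    exact_mod_cast this

lemma card_gridIndex_le {r ρ : ℝ} (hr : 0 ≤ r) (hρ : 0 < ρ) (hρ1 : ρ ≤ 1) :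
    ((gridIndex d r ρ).card : ℝ) ≤ (2 * r + 3) ^ d / ρ ^ d := by
  have h0 : 0 ≤ ⌈r / ρ⌉ := Int.ceil_nonneg (by positivity)
  have h1 : (gridIndex d r ρ).card = (2 * ⌈r / ρ⌉ + 1).toNat ^ d := by
    rw [gridIndex, Pi.card_Icc]
    simp only [Int.card_Icc, Finset.prod_const, Finset.card_univ, Fintype.card_fin]
    congr 2; ring
  rw [h1, ← div_pow]
  push_cast
  refine pow_le_pow_left₀ (by positivity) ?_ d
  have h2 : (((2 * ⌈r / ρ⌉ + 1).toNat : ℕ) : ℝ) = 2 * (⌈r / ρ⌉ : ℝ) + 1 := by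
    have : (((2 * ⌈r / ρ⌉ + 1).toNat : ℕ) : ℤ) = 2 * ⌈r / ρ⌉ + 1 := Int.toNat_of_nonneg (by omega)
    exact_mod_cast this
  rw [h2, le_div_iff₀ hρ]
  have h3 : (⌈r / ρ⌉ : ℝ) * ρ ≤ r + ρ := by
    have := mul_le_mul_of_nonneg_right (Int.ceil_lt_add_one (r / ρ)).le hρ.le
    rwa [add_mul, div_mul_cancel₀ _ hρ.ne', one_mul] at this
  nlinarith

/-- The bandwidth condition beats the number of cells. -/
lemma eventually_card_gridIndex_mul_exp_le {h : ℕ → ℝ} (hh_pos : ∀ n, 0 < h n)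
    (hh_zero : Tendsto h atTop (𝓝 0))
    (hh_rate : Tendsto (fun n : ℕ => n * h n ^ d / |Real.log n|) atTop atTop)
    {r δ κ : ℝ} (hr : 0 ≤ r) (hδ0 : 0 < δ) (hδ1 : δ ≤ 1) (hκ : 0 < κ) :
    ∀ᶠ m : ℕ in atTop,
      ((gridIndex d r (δ * h m)).card : ℝ) * Real.exp (-(κ * (m * h m ^ d))) ≤ 1 / (m : ℝ) ^ 3 := by
  set D : ℝ := (2 * r + 3) ^ d / δ ^ d with hD
  -- The summand `5 / κ` gives an exponential bound `m⁻⁵`; the summand `2`, with `log m ≥ 1/2`,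
  -- gives `m h^d ≥ 1` and hence at most `D / h^d ≤ m²` cells. The surplus `m⁻³` stays summable
  -- after a union over `O(m)` bandwidths.
  filter_upwards [hh_zero.eventually_lt_const one_pos, hh_rate.eventually_ge_atTop (5 / κ + 2),
    eventually_ge_atTop ⌈D⌉₊, eventually_ge_atTop 2] with m hm1 hm2 hm3 hm4
  have hm0 : (0 : ℝ) < m := by positivity
  have hhm := hh_pos m
  have hlog : 0 < Real.log m := Real.log_pos (by exact_mod_cast hm4)
  have hlog2 : 1 / 2 ≤ Real.log m := by
    have h1 : Real.log 2 ≤ Real.log m := Real.log_le_log (by norm_num) (by exact_mod_cast hm4)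
    linarith [Real.log_two_gt_d9]
  rw [abs_of_pos hlog, le_div_iff₀ hlog] at hm2
  have hκl : 0 ≤ 5 / κ * Real.log m := by positivity
  have hge1 : 1 ≤ m * h m ^ d := by nlinarith
  have hexp : Real.exp (-(κ * (m * h m ^ d))) ≤ 1 / (m : ℝ) ^ 5 := by
    have : 5 * Real.log m ≤ κ * (m * h m ^ d) := by
      have h1 : 5 / κ * Real.log m ≤ m * h m ^ d := by nlinarith
      have h2 := mul_le_mul_of_nonneg_left h1 hκ.le
      have h3 : κ * (5 / κ * Real.log m) = 5 * Real.log m := by field_simp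
      linarith
    calc Real.exp (-(κ * (m * h m ^ d))) ≤ Real.exp (-(5 * Real.log m)) :=
          Real.exp_le_exp.2 (by linarith)
      _ = 1 / (m : ℝ) ^ 5 := by
          rw [Real.exp_neg, ← Real.exp_log (pow_pos hm0 5), Real.log_pow, one_div]
          norm_num
  have hcard : ((gridIndex d r (δ * h m)).card : ℝ) ≤ (m : ℝ) ^ 2 := by
    have hρ : δ * h m ≤ 1 := by nlinarith
    refine (card_gridIndex_le hr (by positivity) hρ).trans ?_
    have h1 : (2 * r + 3) ^ d / (δ * h m) ^ d = D * (1 / h m ^ d) := by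
      rw [mul_pow, hD]; field_simp
    have h2 : D ≤ m := (Nat.le_ceil D).trans (by exact_mod_cast hm3)
    have h3 : 1 / h m ^ d ≤ m := by
      rw [div_le_iff₀ (by positivity)]; exact hge1
    rw [h1, sq]
    exact mul_le_mul h2 h3 (by positivity) hm0.le
  calc _ ≤ (m : ℝ) ^ 2 * (1 / (m : ℝ) ^ 5) :=
        mul_le_mul hcard hexp (Real.exp_pos _).le (by positivity)
    _ = 1 / (m : ℝ) ^ 3 := by field_simp

variable {Ω S : Type*} [MeasurableSpace Ω] [MeasurableSpace S] {P : Measure Ω}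
  [IsProbabilityMeasure P] {Λ : Measure S} {x : ℕ → ℕ → Ω → S}

/-- Chernoff bound for deviations that are proportional to an upper bound for the mean. -/
lemma IsIIDPoisson.exists_measure_abs_ge_le (hx : IsIIDPoisson P x Λ) {η D : ℝ} (hη : 0 < η)
    (hD : 0 < D) : ∃ κ : ℝ, 0 < κ ∧ ∀ (B : Set S), MeasurableSet B → Λ B < ∞ →
      ∀ (n : ℕ) (v : ℝ), 0 ≤ v → (Λ B).toReal ≤ D * v →
        P.real {ω | η * (n * v) ≤ |totalCount (fun j i => x j i ω) n B - n * (Λ B).toReal|} ≤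
          2 * Real.exp (-(κ * (n * v))) := by
  -- With this `θ` the quadratic term of the Chernoff exponent is at most half of the linear term `θ
  -- η n v`, leaving `κ = θ η / 2`.
  set θ := min 1 (η / (2 * D)) with hθ
  have hθ0 : 0 < θ := lt_min one_pos (by positivity)
  have hθ1 : θ ≤ 1 := min_le_left _ _
  have hθ2 : θ * (2 * D) ≤ η := (le_div_iff₀ (by positivity)).1 (min_le_right _ _)
  refine ⟨θ * η / 2, by positivity, fun B hB hΛ n v hv hle => ?_⟩
  refine (hx.measure_abs_ge_le hB hΛ n hθ0.le hθ1 _).trans ?_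
  gcongr
  have hnv : 0 ≤ (n : ℝ) * v := by positivity
  have h1 : n * (Λ B).toReal * θ ^ 2 ≤ n * (D * v) * θ ^ 2 := by gcongr
  have h2 : n * (D * v) * θ ^ 2 ≤ θ * η / 2 * (n * v) := by
    have := mul_le_mul_of_nonneg_left hθ2 (by positivity : 0 ≤ θ * (n * v) / 2)
    nlinarith
  nlinarith

/-- Borel–Cantelli for exceptional sets that need not be measurable. -/
lemma ae_eventually_of_summable {p : ℕ → Ω → Prop} {u : ℕ → ℝ} (hu : Summable u)
    (h : ∀ᶠ n in atTop, P.real {ω | ¬ p n ω} ≤ u n) : ∀ᵐ ω ∂P, ∀ᶠ n in atTop, p n ω := by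
  have hs : Summable fun n => P.real {ω | ¬ p n ω} := by
    refine Summable.of_norm_bounded_eventually_nat hu ?_
    filter_upwards [h] with n hn
    rwa [Real.norm_of_nonneg measureReal_nonneg]
  have h2 : ∑' n, P {ω | ¬ p n ω} ≠ ∞ := by
    have h3 : ∀ n, P {ω | ¬ p n ω} = ENNReal.ofReal (P.real {ω | ¬ p n ω}) := fun n => by simp
    simp_rw [h3]
    exact hs.tsum_ofReal_ne_top
  filter_upwards [ae_eventually_notMem h2] with ω hω
  filter_upwards [hω] with n hn
  simpa using hn

/-- Law of large numbers for the number of points in a set. -/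
lemma IsIIDPoisson.ae_tendsto_totalCount_div (hx : IsIIDPoisson P x Λ) {B : Set S}
    (hB : MeasurableSet B) (hΛ : Λ B < ∞) :
    ∀ᵐ ω ∂P, Tendsto (fun n : ℕ => totalCount (fun j i => x j i ω) n B / n) atTop
      (𝓝 (Λ B).toReal) := by
  have key : ∀ q : ℕ, ∀ᵐ ω ∂P, ∀ᶠ n : ℕ in atTop,
      |totalCount (fun j i => x j i ω) n B - n * (Λ B).toReal| < 1 / ((q : ℝ) + 1) * (n * 1) := by
    intro q
    obtain ⟨κ, hκ, hle⟩ := hx.exists_measure_abs_ge_le (η := 1 / ((q : ℝ) + 1))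
      (D := (Λ B).toReal + 1) (by positivity) (by positivity)
    refine ae_eventually_of_summable (u := fun n => 2 * Real.exp (n * -κ)) ?_
      (Eventually.of_forall fun n => ?_)
    · exact (Real.summable_exp_nat_mul_iff.2 (by linarith)).mul_left 2
    · simp_rw [not_lt]
      refine (hle B hB hΛ n 1 zero_le_one (by linarith)).trans (le_of_eq ?_)
      congr 2; ring
  filter_upwards [ae_all_iff.2 key] with ω hω
  rw [Metric.tendsto_nhds]
  intro ε hε
  obtain ⟨q, hq⟩ := exists_nat_one_div_lt hε
  filter_upwards [hω q, eventually_gt_atTop 0] with n hn hn0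
  have hn0' : (0 : ℝ) < n := by exact_mod_cast hn0
  rw [Real.dist_eq, div_sub' hn0'.ne', abs_div, abs_of_pos hn0', div_lt_iff₀ hn0']
  nlinarith

end GridCounts

/-! ### Simultaneous concentration over cells and bandwidths. -/

section CellConcentration

variable {d : ℕ} {Ω S : Type*} [MeasurableSpace Ω] [MeasurableSpace S] {P : Measure Ω}
  [IsProbabilityMeasure P] {Λ : Measure S} {x : ℕ → ℕ → Ω → S}

lemma totalCount_eq_zero {x : ℕ → ℕ → S} {B : Set S} (hB : MeasurableSet B)
    (h : ∀ j i, x j i ∉ B) (n : ℕ) : totalCount x n B = 0 := by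
  refine Finset.sum_eq_zero fun j _ => ?_
  rw [pointMeasure_apply hB]
  simp [h]

/-- The numbers of points in the cells of a grid whose mesh is proportional to the bandwidth are
uniformly close to their means, for all bandwidths with index between `c n / 2` and `2 c n`. -/
lemma IsIIDPoisson.ae_eventually_cell (hx : IsIIDPoisson P x Λ) {T : Set S}
    (hT : MeasurableSet T) {π : S → E d} (hπ : Measurable π) {F : Measure (E d)}
    [IsFiniteMeasure F] (hF : ∀ A, MeasurableSet A → Λ (T ∩ π ⁻¹' A) = F A) {D r : ℝ} (hD : 0 < D)
    (hr : 0 ≤ r) (hFD : ∀ A, F A ≤ ENNReal.ofReal D * volume A)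
    (hFr : F (Metric.closedBall 0 r)ᶜ = 0) {h : ℕ → ℝ} (hh_pos : ∀ n, 0 < h n)
    (hh_zero : Tendsto h atTop (𝓝 0))
    (hh_rate : Tendsto (fun n : ℕ => n * h n ^ d / |Real.log n|) atTop atTop) {c δ η : ℝ}
    (hc : 0 < c) (hδ0 : 0 < δ) (hδ1 : δ ≤ 1) (hη : 0 < η) :
    ∀ᵐ ω ∂P, ∀ᶠ n : ℕ in atTop, ∀ m : ℕ, c * n / 2 ≤ m → (m : ℝ) ≤ 2 * c * n → ∀ z,
      |totalCount (fun j i => x j i ω) n (T ∩ π ⁻¹' cell (δ * h m) z) -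
        n * F.real (cell (δ * h m) z)| ≤ η * (n * h m ^ d) := by
  have hmeas : ∀ m z, MeasurableSet (T ∩ π ⁻¹' cell (δ * h m) z) := fun m z =>
    hT.inter (hπ (measurableSet_cell _ _))
  have hΛ : ∀ m z, Λ (T ∩ π ⁻¹' cell (δ * h m) z) = F (cell (δ * h m) z) := fun m z =>
    hF _ (measurableSet_cell _ _)
  obtain ⟨κ, hκ, hle⟩ := hx.exists_measure_abs_ge_le (η := η) (D := D * δ ^ d) hη (by positivity)
  set bad : ℕ → ℕ → (Fin d → ℤ) → Set Ω := fun n m z =>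
    {ω | η * (n * h m ^ d) ≤ |totalCount (fun j i => x j i ω) n (T ∩ π ⁻¹' cell (δ * h m) z) -
        n * F.real (cell (δ * h m) z)|} with hbad
  have hbadle : ∀ n m z, P.real (bad n m z) ≤ 2 * Real.exp (-(κ * (n * h m ^ d))) := by
    intro n m z
    have hhm := hh_pos m
    have h1 := hle _ (hmeas m z) (by rw [hΛ]; exact measure_lt_top _ _) n (h m ^ d)
      (by positivity) (by
        rw [hΛ]
        refine ENNReal.toReal_le_of_le_ofReal (by positivity) ((hFD _).trans ?_)
        rw [volume_cell (by positivity), ← ENNReal.ofReal_mul hD.le, mul_pow, mul_assoc])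
    rwa [hΛ] at h1
  -- The bandwidth index will be the random number of points, so all indices in a window around `c
  -- n` are controlled at once.
  set I : ℕ → Finset ℕ := fun n =>
    (Finset.range (⌊2 * c * n⌋₊ + 1)).filter fun m => c * n / 2 ≤ (m : ℝ) with hI
  have hgrid : ∀ᵐ ω ∂P, ∀ᶠ n : ℕ in atTop, ∀ m ∈ I n, ∀ z ∈ gridIndex d r (δ * h m),
      ω ∉ bad n m z := by
    -- Since `m ≤ 2 c n`, the exponent satisfies `κ n h^d ≥ (κ / (2 c)) m h^d`; this expresses the
    -- bound through the index of the bandwidth.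
    have hev := eventually_card_gridIndex_mul_exp_le (d := d) hh_pos hh_zero hh_rate hr hδ0 hδ1
      (κ := κ / (2 * c)) (by positivity)
    obtain ⟨m₀, hm₀⟩ := eventually_atTop.1 hev
    refine ae_eventually_of_summable (u := fun n : ℕ => (2 * c + 1) * 16 / c ^ 3 *
      (1 / (n : ℝ) ^ 2)) ((Real.summable_one_div_nat_pow.2 one_lt_two).mul_left _) ?_
    filter_upwards [eventually_ge_atTop ⌈2 * m₀ / c⌉₊, eventually_gt_atTop 0] with n hn hn0
    have hn0' : (1 : ℝ) ≤ n := by exact_mod_cast hn0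
    have hnm : 2 * m₀ / c ≤ n := (Nat.le_ceil _).trans (by exact_mod_cast hn)
    rw [div_le_iff₀ hc] at hnm
    have hsub : {ω | ¬ ∀ m ∈ I n, ∀ z ∈ gridIndex d r (δ * h m), ω ∉ bad n m z} ⊆
        ⋃ m ∈ I n, ⋃ z ∈ gridIndex d r (δ * h m), bad n m z := by
      intro ω hω
      simp only [Set.mem_ofPred_eq] at hω
      push Not at hω
      simpa only [Set.mem_iUnion, exists_prop] using hω
    have hinner : ∀ m ∈ I n, P.real (⋃ z ∈ gridIndex d r (δ * h m), bad n m z) ≤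
        16 / (c * n) ^ 3 := by
      intro m hm
      have hm2 : c * n / 2 ≤ (m : ℝ) := (Finset.mem_filter.1 hm).2
      have hm1 : (m : ℝ) ≤ 2 * c * n := by
        have := Finset.mem_range.1 (Finset.mem_filter.1 hm).1
        exact (Nat.le_floor_iff (by positivity)).1 (Nat.lt_succ_iff.1 this)
      have hmm₀ : m₀ ≤ m := by
        have : (m₀ : ℝ) ≤ m := by linarith
        exact_mod_cast this
      have hhm : 0 < h m ^ d := pow_pos (hh_pos m) d
      have hcn : 0 < c * n := by positivity
      calc P.real (⋃ z ∈ gridIndex d r (δ * h m), bad n m z)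
          ≤ ∑ z ∈ gridIndex d r (δ * h m), P.real (bad n m z) :=
            measureReal_biUnion_finset_le _ _
        _ ≤ ∑ _z ∈ gridIndex d r (δ * h m), 2 * Real.exp (-(κ / (2 * c) * (m * h m ^ d))) := by
            refine Finset.sum_le_sum fun z _ => (hbadle n m z).trans ?_
            refine mul_le_mul_of_nonneg_left (Real.exp_le_exp.2 (neg_le_neg ?_)) two_pos.le
            rw [div_mul_eq_mul_div, div_le_iff₀ (by positivity)]
            have : m * h m ^ d ≤ 2 * c * n * h m ^ d := mul_le_mul_of_nonneg_right hm1 hhm.le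
            nlinarith
        _ = 2 * ((gridIndex d r (δ * h m)).card * Real.exp (-(κ / (2 * c) * (m * h m ^ d)))) := by
            rw [Finset.sum_const, nsmul_eq_mul]; ring
        _ ≤ 2 * (1 / (m : ℝ) ^ 3) := by gcongr; exact hm₀ m hmm₀
        _ ≤ 2 * (1 / (c * n / 2) ^ 3) := by gcongr
        _ = 16 / (c * n) ^ 3 := by field_simp; norm_num
    calc P.real {ω | ¬ ∀ m ∈ I n, ∀ z ∈ gridIndex d r (δ * h m), ω ∉ bad n m z}
        ≤ P.real (⋃ m ∈ I n, ⋃ z ∈ gridIndex d r (δ * h m), bad n m z) :=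
          measureReal_mono hsub (measure_ne_top _ _)
      _ ≤ ∑ m ∈ I n, P.real (⋃ z ∈ gridIndex d r (δ * h m), bad n m z) :=
          measureReal_biUnion_finset_le _ _
      _ ≤ ∑ _m ∈ I n, 16 / (c * n) ^ 3 := Finset.sum_le_sum hinner
      _ = (I n).card * (16 / (c * n) ^ 3) := by rw [Finset.sum_const, nsmul_eq_mul]
      _ ≤ ((2 * c + 1) * n) * (16 / (c * n) ^ 3) := by
          gcongr
          have h1 : (I n).card ≤ ⌊2 * c * n⌋₊ + 1 := by
            simpa using Finset.card_filter_le (Finset.range (⌊2 * c * n⌋₊ + 1))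
              fun m => c * n / 2 ≤ (m : ℝ)
          have h2 : ((I n).card : ℝ) ≤ (⌊2 * c * n⌋₊ : ℝ) + 1 := by exact_mod_cast h1
          have h3 := Nat.floor_le (by positivity : 0 ≤ 2 * c * n)
          linarith
      _ = (2 * c + 1) * 16 / c ^ 3 * (1 / (n : ℝ) ^ 2) := by field_simp
  -- Cells off the finite grid avoid the ball that carries `F`; almost surely they contain no
  -- retained centre, so the union bound can ignore them.
  have hout : ∀ᵐ ω ∂P, ∀ j i, x j i ω ∉ T ∩ π ⁻¹' (Metric.closedBall 0 r)ᶜ := by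
    refine ae_all_iff.2 fun j => (hx.poisson j).ae_forall_notMem ?_
    rw [hF _ Metric.isClosed_closedBall.measurableSet.compl, hFr]
  filter_upwards [hgrid, hout] with ω hω hωout
  filter_upwards [hω] with n hn m hm1 hm2 z
  by_cases hz : z ∈ gridIndex d r (δ * h m)
  · have hmI : m ∈ I n := by
      refine Finset.mem_filter.2 ⟨Finset.mem_range.2 (Nat.lt_succ_iff.2 (Nat.le_floor hm2)), hm1⟩
    exact (not_le.1 (hn m hmI z hz)).le
  · have hsub : cell (δ * h m) z ⊆ (Metric.closedBall (0 : E d) r)ᶜ := by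
      intro t ht htr
      refine hz ?_
      rw [mem_closedBall_zero_iff] at htr
      have := mem_gridIndex (mul_pos hδ0 (hh_pos m)) htr
      rwa [show cellIndex (δ * h m) t = z from ht] at this
    have hF0 : F.real (cell (δ * h m) z) = 0 := by
      rw [measureReal_def, measure_mono_null hsub hFr, ENNReal.toReal_zero]
    rw [hF0, totalCount_eq_zero (hmeas m z)
      fun j i hji => hωout j i ⟨hji.1, hsub hji.2⟩]
    have := hh_pos m
    simp only [mul_zero, sub_zero, abs_zero]
    positivity

end CellConcentration

/-! ### The sample measure and the corrected estimator. -/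

section Assembly

variable {d : ℕ} {K : Set (E d)} {y : E d → ℝ≥0∞} {x : ℕ → ℕ → Storm d}

lemma finite_sampleIndex (hfin : ∀ j, {i | Contributes K y (x j i)}.Finite) (n : ℕ) :
    (sampleIndex K y x n).Finite := by
  classical
  refine ((Finset.range n) ×ˢ
    ((Finset.range n).biUnion fun j => (hfin j).toFinset)).finite_toSet.subset fun q hq => ?_
  simp only [Finset.coe_product, Finset.coe_range, Finset.coe_biUnion, Set.Finite.coe_toFinset]
  exact ⟨hq.1, Set.mem_iUnion₂.2 ⟨q.1, hq.1, hq.2⟩⟩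

/-- The counting measure of the centres of the retained storms. -/
def centreMeasure (x : ℕ → ℕ → Storm d) (s : Finset (ℕ × ℕ)) : Measure (E d) :=
  ∑ q ∈ s, Measure.dirac (x q.1 q.2).1

instance (s : Finset (ℕ × ℕ)) : IsFiniteMeasure (centreMeasure x s) := by
  unfold centreMeasure; infer_instance

lemma integral_centreMeasure {f : E d → ℝ} (hf : Measurable f) (s : Finset (ℕ × ℕ)) :
    ∫ t, f t ∂(centreMeasure x s) = ∑ q ∈ s, f (x q.1 q.2).1 := by
  rw [centreMeasure, integral_finsetSum_measure
    fun q _ => integrable_dirac' hf.stronglyMeasurable (by simp)]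
  simp

/-- Links the Poisson counts of storms to the finite measure on `E d` to which the deterministic
comparison applies. -/
lemma totalCount_eq_measureReal (hfin : ∀ j, {i | Contributes K y (x j i)}.Finite)
    (hT : MeasurableSet {p : Storm d | Contributes K y p}) {A : Set (E d)} (hA : MeasurableSet A)
    (n : ℕ) :
    totalCount x n ({p | Contributes K y p} ∩ Prod.fst ⁻¹' A) =
      (centreMeasure x (finite_sampleIndex hfin n).toFinset).real A := by
  have hB : MeasurableSet ({p : Storm d | Contributes K y p} ∩ Prod.fst ⁻¹' A) :=
    hT.inter (measurable_fst hA)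
  have h1 : (centreMeasure x (finite_sampleIndex hfin n).toFinset).real A =
      ∑ q ∈ (finite_sampleIndex hfin n).toFinset,
        (A.indicator (1 : E d → ℝ≥0∞) (x q.1 q.2).1).toReal := by
    rw [measureReal_def, centreMeasure, Measure.finsetSum_apply, ENNReal.toReal_sum]
    · simp
    · intro q _
      exact measure_ne_top _ _
  rw [h1, totalCount, Finset.sum_finset_product _ (Finset.range n)
    (fun j => (hfin j).toFinset) (fun q => by simp [sampleIndex])]
  refine Finset.sum_congr rfl fun j _ => ?_
  rw [pointMeasure, Measure.sum_apply _ hB, tsum_eq_sum (s := (hfin j).toFinset), ENNReal.toReal_sum]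
  · refine Finset.sum_congr rfl fun i hi => ?_
    have hi' : Contributes K y (x j i) := by simpa using hi
    rw [Measure.dirac_apply' _ hB]
    by_cases hA : (x j i).1 ∈ A <;> simp [hi', hA]
  · intro i _
    exact measure_ne_top _ _
  · intro i hi
    have hi' : ¬ Contributes K y (x j i) := by simpa using hi
    rw [Measure.dirac_apply' _ hB]
    simp [hi']

lemma totalCount_eq_sampleCount (hfin : ∀ j, {i | Contributes K y (x j i)}.Finite)
    (hT : MeasurableSet {p : Storm d | Contributes K y p}) (n : ℕ) :
    totalCount x n {p | Contributes K y p} = sampleCount K y x n := by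
  have h := totalCount_eq_measureReal hfin hT MeasurableSet.univ n
  rw [Set.preimage_univ, Set.inter_univ] at h
  rw [h, measureReal_def, centreMeasure, Measure.finsetSum_apply, sampleCount,
    Set.ncard_eq_toFinset_card _ (finite_sampleIndex hfin n)]
  simp

lemma kernelEstimator_eq {k : E d → ℝ} (hk : Measurable k) (h : ℕ → ℝ)
    (hfin : ∀ j, {i | Contributes K y (x j i)}.Finite) (n : ℕ) (s : E d) :
    kernelEstimator k h K y x n s =
      ((sampleCount K y x n : ℝ) * h (sampleCount K y x n) ^ d)⁻¹ *
        ∫ t, k ((h (sampleCount K y x n))⁻¹ • (s - t))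
          ∂(centreMeasure x (finite_sampleIndex hfin n).toFinset) := by
  rw [kernelEstimator, one_div, integral_centreMeasure
      (f := fun t => k ((h (sampleCount K y x n))⁻¹ • (s - t))) (hk.comp (by fun_prop)),
    finsum_mem_eq_finite_toFinset_sum _ (finite_sampleIndex hfin n)]

/-- The division by the correcting factor, and the passage from the number of samples to the number
of points. -/
lemma tendstoUniformlyOn_inv_mul {α : Type*} {s : Set α} {b ψ : α → ℝ} {c b₀ M : ℝ} (hb₀ : 0 < b₀)
    (hb : ∀ a ∈ s, b₀ ≤ b a) (hM0 : 0 ≤ M) (hM : ∀ a ∈ s, |b a * ψ a| ≤ M) {r : ℕ → ℝ}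
    (hr : Tendsto r atTop (𝓝 1)) {G : ℕ → α → ℝ}
    (hG : ∀ ε : ℝ, 0 < ε → ∀ᶠ n in atTop, ∀ a, |G n a - b a * ψ a| ≤ ε) {g : ℕ → α → ℝ}
    (hg : ∀ᶠ n in atTop, ∀ a, c * g n a = (b a)⁻¹ * (r n * G n a)) :
    TendstoUniformlyOn (fun n a => c * g n a) ψ atTop s := by
  rw [Metric.tendstoUniformlyOn_iff]
  intro ε hε
  have hr1 := Metric.tendsto_nhds.1 hr (min 1 (b₀ * ε / (2 * (M + 1))))
    (lt_min one_pos (by positivity))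
  filter_upwards [hr1, hG (b₀ * ε / 8) (by positivity), hg] with n hn1 hn2 hn3 a ha
  rw [Real.dist_eq] at hn1
  have hr2 : |r n - 1| < 1 := hn1.trans_le (min_le_left _ _)
  have hr3 : |r n - 1| * (2 * (M + 1)) < b₀ * ε := by
    rw [← lt_div_iff₀ (by positivity)]
    exact hn1.trans_le (min_le_right _ _)
  have hba : 0 < b a := hb₀.trans_le (hb a ha)
  -- Here `G` is normalized by `n` instead of `m_n`, and `r = c n / m_n` corrects for this. The two
  -- terms contribute at most `b₀ ε / 4` and `b₀ ε / 2`.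
  have e : c * g n a - ψ a = (b a)⁻¹ * (r n * (G n a - b a * ψ a) + (r n - 1) * (b a * ψ a)) := by
    rw [hn3]; field_simp; ring
  rw [dist_comm, Real.dist_eq, e, abs_mul, abs_of_pos (inv_pos.2 hba), inv_mul_lt_iff₀ hba]
  refine (abs_add_le _ _).trans_lt ?_
  rw [abs_mul, abs_mul]
  have h1 : |r n| ≤ 2 := by
    rw [abs_lt] at hr2; rw [abs_le]; constructor <;> linarith
  have h2 : |r n| * |G n a - b a * ψ a| ≤ 2 * (b₀ * ε / 8) :=
    mul_le_mul h1 (hn2 a) (abs_nonneg _) two_pos.le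
  have h3 : |r n - 1| * |b a * ψ a| ≤ |r n - 1| * M :=
    mul_le_mul_of_nonneg_left (hM a ha) (abs_nonneg _)
  have h4 : b₀ * ε ≤ b a * ε := mul_le_mul_of_nonneg_right (hb a ha) hε.le
  have h5 := abs_nonneg (r n - 1)
  have h6 : 0 < b₀ * ε := by positivity
  nlinarith

/-- Uniform consistency of the corrected estimator for a fixed intensity and a fixed threshold. -/
theorem IsIIDPoisson.ae_tendstoUniformlyOn {C R μ y₀ M : ℝ} {PX : Measure C(E d, ℝ)}
    [IsProbabilityMeasure PX] {ψ : C(E d, ℝ)} (hR : 0 < R) (hμ : 0 < μ) (hψ : ∀ s, 0 < ψ s)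
    (hX : ∀ᵐ X ∂PX, IsShape C R X) (hK : IsCompact K) (hne : K.Nonempty) (hy₀ : 0 < y₀)
    (hy : ∀ t ∈ K, ENNReal.ofReal y₀ ≤ y t) (hyM : ∀ t ∈ K, y t ≤ ENNReal.ofReal M)
    {k : E d → ℝ} (hk : IsSmoothingKernel k) {h : ℕ → ℝ} (hh_pos : ∀ n, 0 < h n)
    (hh_zero : Tendsto h atTop (𝓝 0))
    (hh_rate : Tendsto (fun n : ℕ => n * h n ^ d / |Real.log n|) atTop atTop)
    {Ω : Type*} [MeasurableSpace Ω] {P : Measure Ω} [IsProbabilityMeasure P]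
    {x : ℕ → ℕ → Ω → Storm d} (hx : IsIIDPoisson P x (stormIntensity μ PX ψ)) :
    ∀ᵐ ω ∂P, ∀ ε : ℝ, 0 < ε → TendstoUniformlyOn
      (fun (n : ℕ) (s : E d) =>
        cConst μ PX ψ K y * correctedEstimator μ PX k h K y (fun j i => x j i ω) n s)
      (fun s => ψ s) atTop (K + Metric.closedBall (0 : E d) (R - ε)) := by
  set f := retainedIntensity μ PX ψ K y with hf
  have hfc : Continuous f := continuous_retainedIntensity hy₀ hy hX
  have hfs : HasCompactSupport f := hasCompactSupport_retainedIntensity hX hK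
  have hf0 : ∀ s, 0 ≤ f s := retainedIntensity_nonneg hψ
  have hfu : UniformContinuous f := hfs.uniformContinuous_of_continuous hfc
  have hfi : Integrable f := hfc.integrable_of_hasCompactSupport hfs
  obtain ⟨D, hD⟩ := hfs.exists_bound_of_continuous hfc
  have hfD : ∀ s, f s ≤ |D| + 1 := fun s => by
    have := (le_abs_self _).trans (hD s)
    linarith [le_abs_self D]
  set F := volume.withDensity fun s => ENNReal.ofReal (f s) with hF
  have hFfin : IsFiniteMeasure F := isFiniteMeasure_withDensity_ofReal hfi.2
  set T := {p : Storm d | Contributes K y p} with hTdef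
  have hT : MeasurableSet T := measurableSet_contributes hy₀ hy
  have hΛF : ∀ A, MeasurableSet A → stormIntensity μ PX ψ (T ∩ Prod.fst ⁻¹' A) = F A :=
    fun A hA => stormIntensity_retained hy₀ hy hX hA
  have hΛT : stormIntensity μ PX ψ T = F Set.univ := by
    rw [← hΛF _ MeasurableSet.univ, Set.preimage_univ, Set.inter_univ]
  set c := cConst μ PX ψ K y with hc
  have hc0 : 0 < c := cConst_pos hμ hR hψ hy₀ hy hyM hX hK hne
  have hcF : (stormIntensity μ PX ψ T).toReal = c := by
    rw [hΛT, hF, withDensity_apply _ MeasurableSet.univ, Measure.restrict_univ, hc, cConst]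
    simp_rw [hf, ofReal_retainedIntensity hy₀ hy hX]
  obtain ⟨r, hr⟩ := (hK.add (isCompact_closedBall (0 : E d) R)).isBounded.subset_closedBall 0
  have hFr : F (Metric.closedBall 0 |r|)ᶜ = 0 := by
    rw [hF, withDensity_apply _ Metric.isClosed_closedBall.measurableSet.compl,
      setLIntegral_congr_fun (g := fun _ => 0) Metric.isClosed_closedBall.measurableSet.compl,
      lintegral_zero]
    intro s hs
    have : f s = 0 := retainedIntensity_eq_zero hX fun h =>
      hs (Metric.closedBall_subset_closedBall (le_abs_self r) (hr h))
    simp [this]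
  have hFD : ∀ A, F A ≤ ENNReal.ofReal (|D| + 1) * volume A := fun A => by
    rw [hF, withDensity_apply' _ A, ← setLIntegral_const]
    exact lintegral_mono fun s => ENNReal.ofReal_le_ofReal (hfD s)
  -- Restricting the mesh and the tolerance to `1 / (p + 1)` and `1 / (q + 1)` leaves countably many
  -- events.
  have hcells : ∀ᵐ ω ∂P, ∀ p q : ℕ, ∀ᶠ n : ℕ in atTop, ∀ m : ℕ, c * n / 2 ≤ m →
      (m : ℝ) ≤ 2 * c * n → ∀ z,
      |totalCount (fun j i => x j i ω) n (T ∩ Prod.fst ⁻¹' cell (1 / ((p : ℝ) + 1) * h m) z) -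
        n * F.real (cell (1 / ((p : ℝ) + 1) * h m) z)| ≤ 1 / ((q : ℝ) + 1) * (n * h m ^ d) := by
    refine ae_all_iff.2 fun p => ae_all_iff.2 fun q => ?_
    refine hx.ae_eventually_cell hT measurable_fst hΛF (by positivity) (abs_nonneg r) hFD hFr
      hh_pos hh_zero hh_rate hc0 (by positivity) ?_ (by positivity)
    rw [div_le_one (by positivity)]
    linarith [(Nat.cast_nonneg p : (0 : ℝ) ≤ p)]
  have hTfin : stormIntensity μ PX ψ T < ∞ := by rw [hΛT]; exact measure_lt_top _ _
  filter_upwards [hcells, hx.ae_tendsto_totalCount_div hT hTfin,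
    ae_all_iff.2 fun j => (hx.poisson j).ae_finite hT hTfin] with ω hω hlim hfin ε hε
  set x' : ℕ → ℕ → Storm d := fun j i => x j i ω with hx'
  replace hfin : ∀ j, {i | Contributes K y (x' j i)}.Finite := hfin
  set m : ℕ → ℕ := sampleCount K y x' with hm
  rw [hcF] at hlim
  replace hlim : Tendsto (fun n : ℕ => (m n : ℝ) / n) atTop (𝓝 c) := by
    refine hlim.congr fun n => ?_
    rw [totalCount_eq_sampleCount hfin hT]
  have hmlo : ∀ᶠ n : ℕ in atTop, c * n / 2 ≤ m n := by
    filter_upwards [hlim.eventually_const_le (half_lt_self hc0), eventually_gt_atTop 0]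
      with n hn hn0
    rw [le_div_iff₀ (by exact_mod_cast hn0)] at hn
    linarith
  have hmhi : ∀ᶠ n : ℕ in atTop, (m n : ℝ) ≤ 2 * c * n := by
    filter_upwards [hlim.eventually_le_const (by linarith : c < 2 * c), eventually_gt_atTop 0]
      with n hn hn0
    rwa [div_le_iff₀ (by exact_mod_cast hn0)] at hn
  have hmtop : Tendsto m atTop atTop := by
    rw [← tendsto_natCast_atTop_iff (R := ℝ)]
    refine tendsto_atTop_mono' _ hmlo ?_
    simp_rw [mul_div_right_comm]
    exact tendsto_natCast_atTop_atTop.const_mul_atTop (by positivity)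
  -- The sample path is now fixed, so the random bandwidth `h (m n)` enters as a deterministic
  -- sequence.
  have hG := fun ε' hε' => hk.eventually_abs_sub_le hfu hf0 hfD hfi
    (N := fun n => centreMeasure x' (finite_sampleIndex hfin n).toFinset) (H := fun n => h (m n))
    (fun n => hh_pos _) (hh_zero.comp hmtop) (fun p η hη => by
      obtain ⟨q, hq⟩ := exists_nat_one_div_lt hη
      filter_upwards [hω p q, hmlo, hmhi] with n hn hn1 hn2 z
      rw [← totalCount_eq_measureReal hfin hT (measurableSet_cell _ _)]
      refine (hn (m n) hn1 hn2 z).trans ?_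
      have := hh_pos (m n)
      gcongr) (ε := ε') hε'
  have hK'c : IsCompact (K + Metric.closedBall (0 : E d) (R - ε)) :=
    hK.add (isCompact_closedBall _ _)
  set b : E d → ℝ := fun s => (bFactor μ PX K y s).toReal with hb
  have hbc : Continuous b := ENNReal.continuousOn_toReal.comp_continuous
    (continuous_bFactor hy₀ hy hX) fun s => bFactor_ne_top hy₀ hy hX s
  have hbpos : ∀ s ∈ K + Metric.closedBall (0 : E d) (R - ε), 0 < b s := by
    rintro _ ⟨t, ht, v, hv, rfl⟩
    refine ENNReal.toReal_pos (bFactor_pos hμ hy₀ hy hyM hX ht ?_).ne' (bFactor_ne_top hy₀ hy hX _)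
    rw [mem_closedBall_zero_iff] at hv
    simp only [sub_add_cancel_left, norm_neg]
    linarith
  obtain ⟨b₀, hb₀, hb₀le⟩ : ∃ b₀ : ℝ, 0 < b₀ ∧
      ∀ s ∈ K + Metric.closedBall (0 : E d) (R - ε), b₀ ≤ b s := by
    -- The set is empty when `ε > R`; otherwise compactness gives a positive minimum of `b`.
    rcases (K + Metric.closedBall (0 : E d) (R - ε)).eq_empty_or_nonempty with h | h
    · exact ⟨1, one_pos, by simp [h]⟩
    · obtain ⟨s, hs, hmin⟩ := hK'c.exists_isMinOn h hbc.continuousOn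
      exact ⟨b s, hbpos s hs, fun a ha => hmin ha⟩
  have hrat : Tendsto (fun n : ℕ => c * n / m n) atTop (𝓝 1) := by
    have := (hlim.inv₀ hc0.ne').const_mul c
    rw [mul_inv_cancel₀ hc0.ne'] at this
    refine this.congr fun n => ?_
    rw [inv_div, mul_div_assoc]
  refine tendstoUniformlyOn_inv_mul (b := b) hb₀ hb₀le (by positivity : 0 ≤ |D| + 1)
    (fun s _ => (abs_of_nonneg (hf0 s)).trans_le (hfD s)) hrat hG ?_
  filter_upwards [eventually_gt_atTop 0, hmtop.eventually_gt_atTop 0] with n hn0 hmn0 s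
  rw [correctedEstimator, kernelEstimator_eq hk.measurable h hfin]
  have h1 : (n : ℝ) ≠ 0 := by positivity
  have h2 : (m n : ℝ) ≠ 0 := by positivity
  have h3 := (hh_pos (m n)).ne'
  simp only [← hm, hb]
  field_simp

end Assembly

end CoxExtremal

end

open CoxExtremal in
/-- `PX` is the law of the storm process, `PΨ` the law of the intensity process. Conditionally on
`Ψ = ψ`, the threshold field `Y*` is the extremal field of the Poisson storm process `xs` (on `Ωs`,
under `κs ψ`), and, independently of it, the samples `φ_0, φ_1, …` come from independent Poisson
storm processes `x 0, x 1, …` (on `Ω`, under `κ ψ`) with the same directing measure. The conclusion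
is for almost every `ψ`, almost every realization `y` of `Y*` given `ψ`, and almost surely in the
samples. -/
theorem corollary1 {d : ℕ} (hd : 0 < d)
    -- the storm process
    (PX : Measure C(E d, ℝ)) [IsProbabilityMeasure PX]
    (hX_nonneg : ∀ᵐ X ∂PX, ∀ s, 0 ≤ X s)
    (C R : ℝ) (hC : 0 < C) (hR : 0 < R)
    (hX_bdd : ∀ᵐ X ∂PX, ∀ s, X s ≤ C * (Metric.closedBall (0 : E d) R).indicator 1 s)
    (hX_supp : ∃ r : ℝ, 0 < r ∧
      0 < PX {X | Metric.closedBall (0 : E d) r ⊆ {s | 0 < X s}})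
    (hX_pos : ∀ᵐ X ∂PX, ∀ s : E d, ‖s‖ < R → 0 < X s)
    -- the intensity process and the scaling constant
    (PΨ : Measure C(E d, ℝ)) [IsProbabilityMeasure PΨ]
    (hΨ_pos : ∀ᵐ ψ ∂PΨ, ∀ s, 0 < ψ s)
    (μ : ℝ) (hμ : 0 < μ)
    -- conditionally on the intensity: the storms that generate the threshold field
    {Ωs : Type*} [MeasurableSpace Ωs] (κs : Kernel C(E d, ℝ) Ωs) [IsMarkovKernel κs]
    (xs : ℕ → Ωs → Storm d)
    (hxs : ∀ᵐ ψ ∂PΨ, IsPoissonProcess (κs ψ) xs (stormIntensity μ PX ψ))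
    -- conditionally on the intensity and the threshold: the storms that generate the samples
    {Ω : Type*} [MeasurableSpace Ω] (κ : Kernel C(E d, ℝ) Ω) [IsMarkovKernel κ]
    (x : ℕ → ℕ → Ω → Storm d)
    (hx : ∀ᵐ ψ ∂PΨ, IsIIDPoisson (κ ψ) x (stormIntensity μ PX ψ))
    -- the compact set, the kernel and the bandwidths
    (K : Set (E d)) (hK : IsCompact K)
    (k : E d → ℝ) (hk : IsSmoothingKernel k)
    (h : ℕ → ℝ) (hh_pos : ∀ n, 0 < h n) (hh_zero : Tendsto h atTop (𝓝 0))
    (hh_rate : Tendsto (fun n : ℕ => n * h n ^ d / |Real.log n|) atTop atTop) :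
    ∀ᵐ ψ ∂PΨ, ∀ᵐ ωs ∂(κs ψ), ∀ᵐ ω ∂(κ ψ), ∀ ε : ℝ, 0 < ε →
      TendstoUniformlyOn
        (fun (n : ℕ) (s : E d) =>
          cConst μ PX ψ K (extremalField fun i => xs i ωs) *
            correctedEstimator μ PX k h K (extremalField fun i => xs i ωs)
              (fun j i => x j i ω) n s)
        (fun s => ψ s) atTop (K + Metric.closedBall (0 : E d) (R - ε)) := by
  -- For empty `K` the convergence is over the empty set; it is separated because positivity of `c`
  -- needs a point of `K`.
  rcases K.eq_empty_or_nonempty with rfl | hne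
  · simp [tendstoUniformlyOn_empty]
  have hX := ae_isShape hC hX_nonneg hX_bdd hX_pos
  filter_upwards [hΨ_pos, hxs, hx] with ψ hψ hψs hψx
  filter_upwards [hψs.ae_extremalField_le hC hX hK,
    hψs.ae_le_extremalField hμ hR hψ hX hK] with ωs hωM hωy
  obtain ⟨M, hM⟩ := hωM
  obtain ⟨y₀, hy₀, hy⟩ := hωy
  exact hψx.ae_tendstoUniformlyOn hR hμ hψ hX hK hne hy₀ hy hM hk hh_pos hh_zero hh_rate
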